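/- For integers $n\ge 1$ and $k\ge 1$, let $G_{n,k}$ be the uniform attachment graph: its vertex set is $\{1,\dots,n\}$, each vertex $j\in\{2,\dots,n\}$ makes $k$ choices from $\{1,\dots,j-1\}$, all choices being uniform and independent, and $j$ is joined by an edge to each vertex that it chose; edge orientations and multiplicities are disregarded, so that $G_{n,k}$ is a random simple undirected graph. Call a matching of a graph perfect if it leaves at most one vertex unmatched. Then $$\lim_{n\to\infty}\mathbb P\big(G_{n,5}\text{ has a perfect matching}\big)=1.$$ -/

import Mathlib

namespace UniformAttachment

open MeasureTheory

/-- The vertices of `Fin n` other than the first one, i.e. those that make choices on arrival.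
The vertex `j ∈ {1, …, n}` is represented by the index `i = j - 1 : Fin n`, so that the vertices
preceding it are exactly the `i = j - 1` indices below `i`. -/
abbrev Chooser (n : ℕ) : Type := {i : Fin n // 0 < (i : ℕ)}

instance instNonemptyChoice {n : ℕ} (i : Chooser n) : Nonempty (Fin (i.1 : ℕ)) :=
  ⟨⟨0, i.2⟩⟩

/-- All choices made in the attachment process: `c (i, r)` is the `r`-th choice of the vertex `i`,
one of the earlier vertices `0, …, i - 1`. -/
abbrev Choices (n k : ℕ) : Type := (p : Chooser n × Fin k) → Fin (p.1.1 : ℕ)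

/-- The law of the choices: they are independent (product measure), and each choice of the vertex
`i` is uniform on the vertices preceding `i`. -/
noncomputable def choiceLaw (n k : ℕ) : Measure (Choices n k) :=
  Measure.pi fun p : Chooser n × Fin k => (PMF.uniformOfFintype (Fin (p.1.1 : ℕ))).toMeasure

/-- The uniform attachment graph determined by the choices `c`: distinct `u`, `v` are adjacent iff
one of them chose the other at least once (orientations and multiplicities are disregarded). -/
def graph {n k : ℕ} (c : Choices n k) : SimpleGraph (Fin n) :=
  SimpleGraph.fromRel fun u v =>
    ∃ (hu : 0 < (u : ℕ)) (r : Fin k), (c (⟨u, hu⟩, r) : ℕ) = (v : ℕ)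

/-- A perfect matching, in the sense that accommodates odd orders: a matching that leaves at most
one vertex unmatched. -/
def HasPerfectMatching {V : Type*} (G : SimpleGraph V) : Prop :=
  ∃ M : G.Subgraph, M.IsMatching ∧ M.vertsᶜ.encard ≤ 1

end UniformAttachment

/-! ### Tutte's theorem and the four obstructions. -/

namespace UniformAttachment

open Finset

/-! For even n, Tutte's theorem and parity turn the absence of a perfect matching into a set T and
at least |T| + 2 disjoint odd sets, whose outgoing edges all end in T. If |T| is maximal, every
non-singleton among them has inner degree at least two (`exists_isSeparatedFamily_innerDegree`).
Counting then yields one of four obstructions (`exists_obstruction`), for a small linear threshold t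
and a much smaller slack h: a small U whose outgoing edges end in a set of size |U|; a larger U, at
most half of the vertices, cut off by t vertices; an independent U of linear size with all
neighbours in a set of size |U| + h; or more than h disjoint sets of inner degree two.

The first three are excluded by union bounds over U and S. The choices are independent, so each
event has a product bound, which is largest when S arrives first (`prod_encloses_le`,
`prod_isolates_le`). With five choices per vertex, its fifth power beats the number of pairs.

For the fourth, a set of r vertices with inner degree two contains at least r choices made inside
it. Hence the expected number of such sets of bounded size avoiding the earliest vertices is
bounded. In a disjoint family few sets are large and few meet the earliest vertices, so Markov's
inequality finishes (`choiceLaw_real_exists_family_le`).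

For odd n, a perfect matching on the first n - 1 vertices is enough. -/

/-- Every edge leaving `U` ends in `S`. -/
def Encloses {V : Type*} (G : SimpleGraph V) (U S : Finset V) : Prop :=
  ∀ v ∈ U, ∀ w, G.Adj v w → w ∈ U ∨ w ∈ S

/-- Every edge with an end in `U` has its other end in `S`. -/
def Isolates {V : Type*} (G : SimpleGraph V) (U S : Finset V) : Prop :=
  ∀ v ∈ U, ∀ w, G.Adj v w → w ∈ S

/-- Every vertex of `C` has at least two neighbours in `C`. -/
def HasInnerDegreeTwo {V : Type*} (G : SimpleGraph V) (C : Finset V) : Prop :=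
  ∀ v ∈ C, ∃ x ∈ C, ∃ y ∈ C, x ≠ y ∧ G.Adj v x ∧ G.Adj v y

/-- A family of disjoint odd sets of vertices that are separated from each other by `T`. -/
structure IsSeparatedFamily {V : Type*} (G : SimpleGraph V) (T : Finset V)
    (F : Finset (Finset V)) : Prop where
  odd : ∀ C ∈ F, Odd C.card
  disjoint : ∀ C ∈ F, Disjoint C T
  pairwiseDisjoint : (F : Set (Finset V)).PairwiseDisjoint id
  encloses : ∀ C ∈ F, Encloses G C T

section

variable {V : Type*} [DecidableEq V] {G : SimpleGraph V}

/-- The sets are the odd components left by `u`. Tutte gives an excess of one; since the order is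
even, the number of odd components has the parity of |u|, so the excess is at least two. -/
theorem exists_isSeparatedFamily_of_isTutteViolator [Fintype V] (hV : Even (Fintype.card V))
    {u : Set V} (hu : G.IsTutteViolator u) :
    ∃ T F, IsSeparatedFamily G T F ∧ T.card + 2 ≤ F.card := by
  classical
  unfold SimpleGraph.IsTutteViolator at hu
  set H := ((⊤ : G.Subgraph).deleteVerts u) with hH
  have hverts : ∀ v, v ∈ H.verts ↔ v ∉ u := by intro v; simp [hH]
  have hadj : ∀ v w, v ∉ u → w ∉ u → G.Adj v w → H.Adj v w := by
    intro v w hv hw h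
    simp [hH, hv, hw, h]
  have hodd := H.coe.odd_ncard_oddComponents
  have hcard : Nat.card H.verts + u.ncard = Fintype.card V := by
    have h1 : H.verts = uᶜ := by ext v; simp [hverts]
    rw [Nat.card_coe_set_eq, h1, add_comm, Set.ncard_add_ncard_compl, Nat.card_eq_fintype_card]
  have h2 : u.ncard + 2 ≤ H.coe.oddComponents.ncard := by
    rcases Nat.even_or_odd u.ncard with h | h
    · have : Even (Nat.card H.verts) := by
        rw [← hcard, Nat.even_add] at hV; exact hV.2 h
      have h3 : ¬ Odd (H.coe.oddComponents.ncard) := by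
        rw [hodd]; exact Nat.not_odd_iff_even.2 this
      rw [Nat.not_odd_iff_even] at h3
      obtain ⟨x, hx⟩ := h; obtain ⟨y, hy⟩ := h3; omega
    · have : Odd (Nat.card H.verts) := by
        rw [← hcard, Nat.even_add] at hV
        by_contra h'
        rw [Nat.not_odd_iff_even] at h'
        exact (Nat.not_odd_iff_even.2 (hV.1 h')) h
      have h3 := hodd.2 this
      obtain ⟨x, hx⟩ := h; obtain ⟨y, hy⟩ := h3; omega
  let f : H.coe.ConnectedComponent → Finset V :=
    fun K => (Subtype.val '' K.supp).toFinset
  have hf : ∀ K v, v ∈ f K ↔ ∃ h : v ∈ H.verts, H.coe.connectedComponentMk ⟨v, h⟩ = K := by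
    intro K v
    simp [f]
  have hinj : Function.Injective f := by
    intro K K' hKK
    obtain ⟨⟨v, hv⟩, rfl⟩ := K.exists_rep
    have h1 : v ∈ f (H.coe.connectedComponentMk ⟨v, hv⟩) := (hf _ _).2 ⟨hv, rfl⟩
    have h1' : v ∈ f K' := by rw [← hKK]; exact h1
    obtain ⟨_, h⟩ := (hf _ _).1 h1'
    exact h
  refine ⟨u.toFinset, H.coe.oddComponents.toFinset.image f, ⟨?_, ?_, ?_, ?_⟩, ?_⟩
  · intro C hC
    simp only [mem_image, Set.mem_toFinset] at hC
    obtain ⟨K, hK, rfl⟩ := hC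
    have : Odd K.supp.ncard := hK
    rw [← Set.ncard_eq_toFinset_card', Set.ncard_image_of_injective _ Subtype.val_injective]
    exact this
  · intro C hC
    simp only [mem_image, Set.mem_toFinset] at hC
    obtain ⟨K, hK, rfl⟩ := hC
    rw [Finset.disjoint_left]
    intro v hv
    obtain ⟨h, -⟩ := (hf _ _).1 hv
    simpa using (hverts v).1 h
  · intro C hC C' hC' hne
    simp only [coe_image, Set.mem_image, mem_coe, Set.mem_toFinset] at hC hC'
    obtain ⟨K, hK, rfl⟩ := hC
    obtain ⟨K', hK', rfl⟩ := hC'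
    simp only [Function.onFun, id]
    rw [Finset.disjoint_left]
    intro v hv hv'
    obtain ⟨h, e⟩ := (hf _ _).1 hv
    obtain ⟨h', e'⟩ := (hf _ _).1 hv'
    exact hne (by rw [← e, ← e'])
  · intro C hC v hv w hvw
    simp only [mem_image, Set.mem_toFinset] at hC
    obtain ⟨K, hK, rfl⟩ := hC
    obtain ⟨h, e⟩ := (hf _ _).1 hv
    by_cases hw : w ∈ u
    · right; simpa using hw
    · left
      refine (hf _ _).2 ⟨(hverts w).2 hw, ?_⟩
      rw [← e]
      apply SimpleGraph.ConnectedComponent.connectedComponentMk_eq_of_adj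
      exact (hadj v w ((hverts v).1 h) hw hvw).symm
  · rw [Finset.card_image_of_injective _ hinj, ← Set.ncard_eq_toFinset_card',
      ← Set.ncard_eq_toFinset_card']
    exact h2

/-- If a member of a separated family is not a singleton and has a vertex of inner degree at most
one, then the separator can be enlarged at no loss. -/
theorem IsSeparatedFamily.exists_larger {T : Finset V} {F : Finset (Finset V)}
    (hF : IsSeparatedFamily G T F) {C : Finset V} (hC : C ∈ F) (h1 : C.card ≠ 1)
    (h2 : ¬ HasInnerDegreeTwo G C) :
    ∃ T' F', IsSeparatedFamily G T' F' ∧ T'.card = T.card + 1 ∧ F'.card = F.card + 1 := by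
  have hodd := hF.odd C hC
  have h3 : 3 ≤ C.card := by obtain ⟨x, hx⟩ := hodd; omega
  -- If `v` has no neighbour in `C`, any other vertex of `C` can serve as `w`.
  obtain ⟨v, hv, w, hw, hvw, hnb⟩ : ∃ v ∈ C, ∃ w ∈ C, v ≠ w ∧ ∀ x ∈ C, G.Adj v x → x = w := by
    unfold HasInnerDegreeTwo at h2
    push Not at h2
    obtain ⟨v, hv, h⟩ := h2
    by_cases hx : ∃ x ∈ C, G.Adj v x
    · obtain ⟨x, hxC, hx⟩ := hx
      refine ⟨v, hv, x, hxC, hx.ne, fun y hy hvy => ?_⟩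
      by_contra hne
      exact h x hxC y hy (Ne.symm hne) hx hvy
    · push Not at hx
      obtain ⟨w, hw, hne⟩ := Finset.exists_mem_ne (by omega : 1 < C.card) v
      exact ⟨v, hv, w, hw, hne.symm, fun x hxC h => absurd h (hx x hxC)⟩
  set D := (C.erase w).erase v with hD
  have hvw' : v ∈ C.erase w := mem_erase.2 ⟨hvw, hv⟩
  have hDcard : D.card + 2 = C.card := by
    rw [hD, card_erase_of_mem hvw', card_erase_of_mem hw]; omega
  have hDC : D ⊆ C := (erase_subset _ _).trans (erase_subset _ _)
  have hwT : w ∉ T := Finset.disjoint_left.1 (hF.disjoint C hC) hw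
  have hvT : v ∉ T := Finset.disjoint_left.1 (hF.disjoint C hC) hv
  have hother : ∀ B ∈ F.erase C, Disjoint B C := by
    intro B hB
    exact hF.pairwiseDisjoint (mem_coe.2 (mem_of_mem_erase hB)) (mem_coe.2 hC) (ne_of_mem_erase hB)
  have hDv : Disjoint ({v} : Finset V) D := by simp [hD]
  have hDne : D.Nonempty := by rw [← card_pos]; omega
  have hDF : D ∉ F.erase C := fun h => by
    obtain ⟨x, hx⟩ := hDne
    exact Finset.disjoint_left.1 (hother D h) hx (hDC hx)
  have hvF : {v} ∉ insert D (F.erase C) := by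
    rw [mem_insert, not_or]
    constructor
    · intro h
      rw [h] at hDv
      exact hDne.ne_empty (disjoint_self.1 hDv)
    · intro h
      exact Finset.disjoint_left.1 (hother _ h) (mem_singleton_self v) hv
  -- With `w` moved to the separator, `v` has no neighbour left in `C`, so `C` gives way to the two
  -- odd sets `{v}` and `D`.
  refine ⟨insert w T, insert {v} (insert D (F.erase C)), ⟨?_, ?_, ?_, ?_⟩, ?_, ?_⟩
  · intro B hB
    rcases mem_insert.1 hB with rfl | hB
    · simp
    rcases mem_insert.1 hB with rfl | hB
    · obtain ⟨x, hx⟩ := hodd; exact ⟨x - 1, by omega⟩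
    · exact hF.odd B (mem_of_mem_erase hB)
  · intro B hB
    rw [disjoint_insert_right]
    rcases mem_insert.1 hB with rfl | hB
    · simp [hvw.symm, hvT]
    rcases mem_insert.1 hB with rfl | hB
    · refine ⟨by simp [hD], disjoint_of_subset_left hDC (hF.disjoint C hC)⟩
    · exact ⟨fun h => Finset.disjoint_left.1 (hother B hB) h hw,
        hF.disjoint B (mem_of_mem_erase hB)⟩
  · rw [coe_insert, coe_insert]
    refine Set.PairwiseDisjoint.insert (Set.PairwiseDisjoint.insert ?_ ?_) ?_
    · exact hF.pairwiseDisjoint.subset (by exact_mod_cast erase_subset _ _)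
    · intro B hB _
      exact (disjoint_of_subset_right hDC (hother B (mem_coe.1 hB))).symm
    · intro B hB _
      rcases Set.mem_insert_iff.1 hB with rfl | hB
      · exact hDv
      · exact (disjoint_of_subset_right (singleton_subset_iff.2 hv)
          (hother B (mem_coe.1 hB))).symm
  · intro B hB x hx y hxy
    rcases mem_insert.1 hB with rfl | hB
    · rw [mem_singleton] at hx
      subst hx
      rcases hF.encloses C hC x hv y hxy with h | h
      · right; rw [hnb y h hxy]; exact mem_insert_self _ _
      · right; exact mem_insert_of_mem h
    rcases mem_insert.1 hB with rfl | hB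
    · rcases hF.encloses C hC x (hDC hx) y hxy with h | h
      · by_cases hyw : y = w
        · right; simp [hyw]
        · left
          refine mem_erase.2 ⟨?_, mem_erase.2 ⟨hyw, h⟩⟩
          rintro rfl
          have := hnb x (hDC hx) hxy.symm
          subst this
          simp [hD] at hx
      · right; exact mem_insert_of_mem h
    · rcases hF.encloses B (mem_of_mem_erase hB) x hx y hxy with h | h
      · exact Or.inl h
      · exact Or.inr (mem_insert_of_mem h)
  · exact card_insert_of_notMem hwT
  · rw [card_insert_of_notMem hvF, card_insert_of_notMem hDF, card_erase_of_mem hC]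
    have := card_pos.2 ⟨C, hC⟩
    omega

/-- Take |T| maximal subject to the excess of two: `IsSeparatedFamily.exists_larger` preserves that
excess while enlarging T, so it cannot apply. -/
theorem exists_isSeparatedFamily_innerDegree [Fintype V] (hV : Even (Fintype.card V))
    (hG : ∀ M : G.Subgraph, ¬ M.IsPerfectMatching) :
    ∃ T F, IsSeparatedFamily G T F ∧ T.card + 2 ≤ F.card ∧
      ∀ C ∈ F, C.card = 1 ∨ HasInnerDegreeTwo G C := by
  have h0 : ∃ u, G.IsTutteViolator u := by
    by_contra! h
    obtain ⟨M, hM⟩ := SimpleGraph.tutte.2 h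
    exact hG M hM
  obtain ⟨u, hu⟩ := h0
  have h1 : ∃ k, ∃ T F, IsSeparatedFamily G T F ∧ T.card + 2 ≤ F.card ∧
      Fintype.card V - T.card = k := by
    obtain ⟨T, F, h, h'⟩ := exists_isSeparatedFamily_of_isTutteViolator hV hu
    exact ⟨_, T, F, h, h', rfl⟩
  classical
  obtain ⟨T, F, hF, hc, hk⟩ := Nat.find_spec h1
  refine ⟨T, F, hF, hc, fun C hC => ?_⟩
  by_contra! hcon
  obtain ⟨T', F', hF', hT', hc'⟩ := hF.exists_larger hC hcon.1 hcon.2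
  have hle := Finset.card_le_univ T'
  refine Nat.find_min h1 (m := Fintype.card V - T'.card) ?_ ⟨T', F', hF', by omega, rfl⟩
  omega

/-- A family of small sets contains a subfamily whose union has size in a given window. -/
theorem exists_subfamily_card_biUnion (F : Finset (Finset V)) {m t : ℕ}
    (hm : ∀ C ∈ F, C.card ≤ m) (ht : t < (F.biUnion id).card) :
    ∃ F' ⊆ F, t < (F'.biUnion id).card ∧ (F'.biUnion id).card ≤ t + m := by
  induction F using Finset.induction_on with
  | empty => simp at ht
  | insert C F hCF ih =>
    by_cases hlt : t < (F.biUnion id).card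
    · obtain ⟨F', hF', h⟩ := ih (fun C hC => hm C (mem_insert_of_mem hC)) hlt
      exact ⟨F', hF'.trans (subset_insert _ _), h⟩
    · refine ⟨insert C F, Subset.rfl, ht, ?_⟩
      rw [biUnion_insert]
      have := card_union_le (id C) (F.biUnion id)
      have := hm C (mem_insert_self _ _)
      simp only [id] at *
      omega

theorem IsSeparatedFamily.encloses_biUnion {T : Finset V} {F F' : Finset (Finset V)}
    (hF : IsSeparatedFamily G T F) (h : F' ⊆ F) :
    Disjoint (F'.biUnion id) T ∧ Encloses G (F'.biUnion id) T := by
  constructor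
  · rw [disjoint_biUnion_left]
    exact fun C hC => hF.disjoint C (h hC)
  · intro v hv w hvw
    obtain ⟨C, hC, hvC⟩ := mem_biUnion.1 hv
    rcases hF.encloses C (h hC) v hvC w hvw with h' | h'
    · exact Or.inl (mem_biUnion.2 ⟨C, hC, h'⟩)
    · exact Or.inr h'

/-- A graph of even order without a perfect matching contains one of four obstructions. -/
theorem exists_obstruction [Fintype V] (hV : Even (Fintype.card V))
    (hG : ∀ M : G.Subgraph, ¬ M.IsPerfectMatching) (m t h : ℕ) (hm : 2 * (m + t) ≤ Fintype.card V)
    (hh : h ≤ t) :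
    (∃ U S, Disjoint U S ∧ 1 ≤ U.card ∧ U.card ≤ m + t ∧ S.card = U.card ∧ Encloses G U S) ∨
    (∃ U S, Disjoint U S ∧ m < U.card ∧ 2 * U.card ≤ Fintype.card V ∧ S.card = t ∧
      Encloses G U S) ∨
    (∃ U S, Disjoint U S ∧ t ≤ U.card + h ∧ 2 * U.card + h ≤ Fintype.card V ∧
      S.card = U.card + h ∧ Isolates G U S) ∨
    (∃ F : Finset (Finset V), (F : Set (Finset V)).PairwiseDisjoint id ∧ h < F.card ∧
      ∀ C ∈ F, C.Nonempty ∧ HasInnerDegreeTwo G C) := by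
  obtain ⟨T, F, hF, hc, hdeg⟩ := exists_isSeparatedFamily_innerDegree hV hG
  -- `Encloses` and `Isolates` are monotone in `S`, so a separator may be padded to a prescribed
  -- size.
  have enlarge : ∀ (U S : Finset V) (r : ℕ), Disjoint U S → S.card ≤ r →
      U.card + r ≤ Fintype.card V → ∃ S', S ⊆ S' ∧ S'.card = r ∧ Disjoint U S' := by
    intro U S r hd h1 h2
    obtain ⟨S', h3, h4, h5⟩ := Finset.exists_subsuperset_card_eq (s := S) (t := Uᶜ) (n := r)
      (by rw [subset_compl_iff_disjoint_left]; exact hd) h1 (by rw [card_compl]; omega)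
    exact ⟨S', h3, h5, by rwa [← subset_compl_iff_disjoint_left]⟩
  have hne : ∀ C ∈ F, C.Nonempty := fun C hC => card_pos.1 (hF.odd C hC).pos
  by_cases htT : T.card < t
  -- More than |T| sets of size at most `m` have a subfamily whose union has size in (|T|, |T| + m];
  -- `T` is then padded to the size of that union.
  · have small : ∀ F' ⊆ F, T.card < F'.card → (∀ C ∈ F', C.card ≤ m) →
        ∃ U S, Disjoint U S ∧ 1 ≤ U.card ∧ U.card ≤ m + t ∧ S.card = U.card ∧
          Encloses G U S := by
      intro F' hF' hcard hsz
      have hun : T.card < (F'.biUnion id).card := by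
        rw [card_biUnion (fun x hx y hy hxy => hF.pairwiseDisjoint (hF' hx) (hF' hy) hxy)]
        calc T.card < F'.card := hcard
          _ = ∑ x ∈ F', 1 := by simp
          _ ≤ _ := sum_le_sum fun x hx => card_pos.2 (hne x (hF' hx))
      obtain ⟨F'', h1, h2, h3⟩ := exists_subfamily_card_biUnion F' hsz hun
      obtain ⟨h4, h5⟩ := hF.encloses_biUnion (h1.trans hF')
      obtain ⟨S', h6, h7, h8⟩ := enlarge _ T (F''.biUnion id).card h4 h2.le (by omega)
      exact ⟨_, S', h8, by omega, by omega, h7,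
        fun v hv w hvw => (h5 v hv w hvw).imp_right fun h => h6 h⟩
    by_cases hbig : ∃ C ∈ F, m < C.card
    · obtain ⟨C, hC, hCm⟩ := hbig
      by_cases hbig' : ∃ B ∈ F.erase C, m < B.card
      · obtain ⟨B, hB, hBm⟩ := hbig'
        right; left
        have hd : Disjoint B C := hF.pairwiseDisjoint (mem_coe.2 (mem_of_mem_erase hB))
          (mem_coe.2 hC) (ne_of_mem_erase hB)
        have hsum : B.card + C.card ≤ Fintype.card V := by
          rw [← card_union_of_disjoint hd]; exact card_le_univ _
        have large : ∀ D ∈ F, m < D.card → 2 * D.card ≤ Fintype.card V → ∃ U S, Disjoint U S ∧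
            m < U.card ∧ 2 * U.card ≤ Fintype.card V ∧ S.card = t ∧ Encloses G U S := by
          intro D hD hDm hD2
          obtain ⟨S', h6, h7, h8⟩ := enlarge D T t (hF.disjoint D hD) htT.le (by omega)
          exact ⟨D, S', h8, hDm, hD2, h7,
            fun v hv w hvw => (hF.encloses D hD v hv w hvw).imp_right fun h => h6 h⟩
        rcases le_total B.card C.card with hle | hle
        · exact large B (mem_of_mem_erase hB) hBm (by omega)
        · exact large C hC hCm (by omega)
      · push Not at hbig'
        left
        -- Discarding the only large member still leaves more than |T| sets; the excess of two is
        -- used here.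
        exact small (F.erase C) (erase_subset _ _) (by rw [card_erase_of_mem hC]; omega) hbig'
    · push Not at hbig
      left
      exact small F Subset.rfl (by omega) hbig
  · push Not at htT
    right; right
    set Q := F.filter fun C => C.card ≠ 1 with hQ
    by_cases hq : h < Q.card
    · right
      refine ⟨Q, hF.pairwiseDisjoint.subset (by exact_mod_cast filter_subset _ _), hq, ?_⟩
      intro C hC
      rw [hQ, mem_filter] at hC
      exact ⟨hne C hC.1, (hdeg C hC.1).resolve_left hC.2⟩
    · left
      set I := (F.filter fun C => C.card = 1).biUnion id with hI
      have hIF := filter_subset (fun C : Finset V => C.card = 1) F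
      have hIcard : I.card = (F.filter fun C => C.card = 1).card := by
        rw [hI, card_biUnion (fun x hx y hy hxy => hF.pairwiseDisjoint (hIF hx) (hIF hy) hxy)]
        rw [card_eq_sum_ones]
        exact sum_congr rfl fun C hC => (mem_filter.1 hC).2
      have hsplit := card_filter_add_card_filter_not (s := F) (fun C => C.card = 1)
      obtain ⟨hId, -⟩ := hF.encloses_biUnion hIF
      rw [← hI] at hId
      have hIT : I.card + T.card ≤ Fintype.card V := by
        rw [← card_union_of_disjoint hId]; exact card_le_univ _
      -- The truncation leaves room for a disjoint set of size |I'| + h. That size is still at least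
      -- |T|, because |I| + |T| is at most the order and |T| + 2 ≤ |I| + h.
      obtain ⟨I', hI', hI'c⟩ := Finset.exists_subset_card_eq
        (show min I.card ((Fintype.card V - h) / 2) ≤ I.card from min_le_left _ _)
      have hsplit' : (F.filter fun C => C.card = 1).card + Q.card = F.card := hsplit
      obtain ⟨S', h6, h7, h8⟩ := enlarge I' T (I'.card + h) (disjoint_of_subset_left hI' hId)
        (by omega) (by omega)
      refine ⟨I', S', h8, by omega, by omega, h7, ?_⟩
      intro v hv w hvw
      obtain ⟨C, hC, hvC⟩ := mem_biUnion.1 (hI' hv)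
      rw [mem_filter] at hC
      rcases hF.encloses C hC.1 v hvC w hvw with h' | h'
      · obtain ⟨x, rfl⟩ := card_eq_one.1 hC.2
        simp only [id, mem_singleton] at hvC h'
        exact absurd (h'.trans hvC.symm) hvw.ne'
      · exact h6 h'

end

end UniformAttachment

/-! ### Product bounds for the enclosure and isolation events. -/

namespace UniformAttachment

open Finset MeasureTheory
open scoped Nat

instance instIsProbabilityMeasureChoiceLaw (n k : ℕ) : IsProbabilityMeasure (choiceLaw n k) := by
  unfold choiceLaw; infer_instance

theorem choiceLaw_real_box {n k : ℕ} (B : (p : Chooser n × Fin k) → Finset (Fin (p.1.1 : ℕ))) :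
    (choiceLaw n k).real {c | ∀ p, c p ∈ B p} =
      ∏ p, ((B p).card : ℝ) / ((p.1.1 : ℕ) : ℝ) := by
  have h : {c : Choices n k | ∀ p, c p ∈ B p} = Set.univ.pi fun p => (B p : Set _) := by
    ext c; simp
  rw [h, measureReal_def, choiceLaw, Measure.pi_pi, ENNReal.toReal_prod]
  refine prod_congr rfl fun p _ => ?_
  rw [PMF.toMeasure_uniformOfFintype_apply _ (Set.toFinite _).measurableSet]
  simp

/-- The enclosure and isolation events are contained in events of this shape, where the allowed
targets depend only on the chooser. Index 0 makes no choice, so the product starts at 1. -/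
theorem choiceLaw_real_forall_mem {n k : ℕ} (A : ℕ → Finset ℕ) :
    (choiceLaw n k).real {c | ∀ p, (c p : ℕ) ∈ A p.1.1} =
      (∏ j ∈ Ico 1 n, (((A j).filter (· < j)).card : ℝ) / (j : ℝ)) ^ k := by
  have h : {c : Choices n k | ∀ p, (c p : ℕ) ∈ A p.1.1} =
      {c | ∀ p, c p ∈ univ.filter fun x : Fin (p.1.1 : ℕ) => (x : ℕ) ∈ A p.1.1} := by
    ext c; simp
  have hcard : ∀ j : ℕ, (univ.filter fun x : Fin j => (x : ℕ) ∈ A j).card =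
      ((A j).filter (· < j)).card := by
    intro j
    refine card_bij (fun x _ => (x : ℕ)) ?_ ?_ ?_
    · intro x hx; simp only [mem_filter, mem_univ, true_and] at hx ⊢; exact ⟨hx, x.2⟩
    · intro x _ y _ h; exact Fin.ext h
    · intro x hx; rw [mem_filter] at hx; exact ⟨⟨x, hx.2⟩, by simpa using hx.1, rfl⟩
  rw [h, choiceLaw_real_box, Fintype.prod_prod_type, ← prod_pow]
  simp only [hcard, prod_const]
  refine prod_bij (fun i _ => ((i.1 : Fin n) : ℕ)) ?_ ?_ ?_ ?_
  · intro i _; rw [mem_Ico]; exact ⟨i.2, i.1.2⟩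
  · intro i _ j _ h; exact Subtype.ext (Fin.ext h)
  · intro j hj; rw [mem_Ico] at hj; exact ⟨⟨⟨j, hj.2⟩, hj.1⟩, mem_univ _, rfl⟩
  · intro i _; simp

/-- The number of elements of `U` below `m`. -/
def countBelow (U : Finset ℕ) (m : ℕ) : ℕ := (U.filter (· < m)).card

theorem countBelow_succ_of_mem {U : Finset ℕ} {m : ℕ} (h : m ∈ U) :
    countBelow U (m + 1) = countBelow U m + 1 := by
  unfold countBelow
  rw [← card_insert_of_notMem (a := m) (s := U.filter (· < m)) (by simp)]
  congr 1
  ext x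
  simp only [mem_filter, mem_insert]
  constructor
  · rintro ⟨h1, h2⟩; rcases Nat.lt_succ_iff_lt_or_eq.1 h2 with h3 | h3
    · exact Or.inr ⟨h1, h3⟩
    · exact Or.inl h3
  · rintro (rfl | ⟨h1, h2⟩)
    · exact ⟨h, Nat.lt_succ_self _⟩
    · exact ⟨h1, by omega⟩

theorem countBelow_succ_of_notMem {U : Finset ℕ} {m : ℕ} (h : m ∉ U) :
    countBelow U (m + 1) = countBelow U m := by
  unfold countBelow
  congr 1
  ext x
  simp only [mem_filter]
  constructor
  · rintro ⟨h1, h2⟩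
    refine ⟨h1, ?_⟩
    have : x ≠ m := fun e => h (e ▸ h1)
    omega
  · rintro ⟨h1, h2⟩; exact ⟨h1, by omega⟩

theorem countBelow_add_le {U S : Finset ℕ} (h : Disjoint U S) (m : ℕ) :
    countBelow U m + countBelow S m ≤ m := by
  unfold countBelow
  rw [← card_union_of_disjoint (disjoint_filter_filter h)]
  calc _ ≤ (range m).card := card_le_card fun x hx => by
        simp only [mem_union, mem_filter] at hx; rw [mem_range]; tauto
    _ = m := card_range m

/-- Needed when a vertex of S arrives after a vertices of U and b of S. Since b (b+1)⋯(b+a) = (b+a)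
· b(b+1)⋯(b+a-1), it reduces for b > 0 to b m ≤ (a+b)(m-a), whose sides differ by a(m-a-b). -/
theorem mul_ascFactorial_le {a b m : ℕ} (h : a + b ≤ m) :
    m * b.ascFactorial a ≤ (b + 1).ascFactorial a * (m - a) := by
  rcases Nat.eq_zero_or_pos b with rfl | hb
  · rcases Nat.eq_zero_or_pos a with rfl | ha
    · simp
    · obtain ⟨a, rfl⟩ := Nat.exists_eq_succ_of_ne_zero ha.ne'
      simp [Nat.zero_ascFactorial]
  · have h1 : b * (b + 1).ascFactorial a = (b + a) * b.ascFactorial a := by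
      rw [← Nat.ascFactorial_succ]
      exact Nat.succ_ascFactorial b a
    obtain ⟨w, rfl⟩ := Nat.exists_eq_add_of_le h
    have h2 : a + b + w - a = b + w := by omega
    rw [h2]
    refine Nat.le_of_mul_le_mul_left ?_ hb
    calc b * ((a + b + w) * b.ascFactorial a) = (b * (a + b + w)) * b.ascFactorial a := by ring
      _ ≤ ((b + a) * (b + w)) * b.ascFactorial a :=
          Nat.mul_le_mul_right _ (by nlinarith [Nat.zero_le (a * w)])
      _ = b * ((b + 1).ascFactorial a * (b + w)) := by rw [← mul_assoc, h1]; ring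

/-- The counterpart for `prod_isolates_le`, with the Bernoulli-type inequality (b+a) b^a ≤ b (b+1)^a
in place of the identity. -/
theorem mul_pow_le {a b m : ℕ} (h : a + b ≤ m) :
    m * b ^ a ≤ (b + 1) ^ a * (m - a) := by
  rcases Nat.eq_zero_or_pos b with rfl | hb
  · rcases Nat.eq_zero_or_pos a with rfl | ha
    · simp
    · simp [ha.ne']
  · have h1 : (b + a) * b ^ a ≤ b * (b + 1) ^ a := by
      clear h
      induction a with
      | zero => simp
      | succ a ih =>
        calc (b + (a + 1)) * b ^ (a + 1) ≤ ((b + a) * (b + 1)) * b ^ a := by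
              rw [pow_succ', ← mul_assoc]
              exact Nat.mul_le_mul_right _ (by nlinarith)
          _ = (b + 1) * ((b + a) * b ^ a) := by ring
          _ ≤ (b + 1) * (b * (b + 1) ^ a) := by gcongr
          _ = _ := by ring
    obtain ⟨w, rfl⟩ := Nat.exists_eq_add_of_le h
    have h2 : a + b + w - a = b + w := by omega
    rw [h2]
    refine Nat.le_of_mul_le_mul_left ?_ hb
    calc b * ((a + b + w) * b ^ a) = (b * (a + b + w)) * b ^ a := by ring
      _ ≤ ((b + a) * (b + w)) * b ^ a :=
          Nat.mul_le_mul_right _ (by nlinarith [Nat.zero_le (a * w)])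
      _ = ((b + a) * b ^ a) * (b + w) := by ring
      _ ≤ (b * (b + 1) ^ a) * (b + w) := by gcongr
      _ = _ := by ring

theorem sub_mul_factorial {a m : ℕ} (h : a < m) : (m - a) * (m - a - 1)! = (m - a)! := by
  exact Nat.mul_factorial_pred (by omega)

/-- Whatever the order in which the elements of `U`, of `S` and of the rest arrive, the number of
choices for which no edge leaves `U`, except to `S`, is at most the number of such choices when
the elements of `S` come first. -/
theorem prod_encloses_le {U S : Finset ℕ} (hd : Disjoint U S) {m : ℕ} (hm : 1 ≤ m) :
    (countBelow U m < m ∧ ∏ j ∈ Ico 1 m, (if j ∈ S then j else if j ∈ U then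
      countBelow S j + countBelow U j else j - countBelow U j) ≤
        (countBelow S m).ascFactorial (countBelow U m) * (m - countBelow U m - 1)!) ∨
    (countBelow U m = m ∧ ∏ j ∈ Ico 1 m, (if j ∈ S then j else if j ∈ U then
      countBelow S j + countBelow U j else j - countBelow U j) ≤ (m - 1)!) := by
  -- The second alternative is forced by index 0, which makes no choice: while only vertices of `U`
  -- have arrived, the ascending factorial of 0 is 0 but the product is not. The first alternative
  -- returns once a vertex outside `U` arrives.
  induction m, hm using Nat.le_induction with
  | base =>
    have h1 := countBelow_add_le hd 1
    rcases Nat.lt_or_ge (countBelow U 1) 1 with h | h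
    · left
      refine ⟨h, ?_⟩
      have : countBelow U 1 = 0 := by omega
      simp [this]
    · right
      exact ⟨by omega, by simp⟩
  | succ m hm ih =>
    have hab := countBelow_add_le hd m
    rw [prod_Ico_succ_top hm]
    set P := ∏ j ∈ Ico 1 m, (if j ∈ S then j else if j ∈ U then
      countBelow S j + countBelow U j else j - countBelow U j)
    by_cases hS : m ∈ S
    · have hU : m ∉ U := fun h => Finset.disjoint_left.1 hd h hS
      rw [if_pos hS, countBelow_succ_of_mem hS, countBelow_succ_of_notMem hU]
      left
      refine ⟨by omega, ?_⟩
      rcases ih with ⟨h1, h2⟩ | ⟨h1, h2⟩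
      · set a := countBelow U m
        set b := countBelow S m
        calc P * m ≤ (b.ascFactorial a * (m - a - 1)!) * m := by gcongr
          _ = (m * b.ascFactorial a) * (m - a - 1)! := by ring
          _ ≤ ((b + 1).ascFactorial a * (m - a)) * (m - a - 1)! :=
              Nat.mul_le_mul_right _ (mul_ascFactorial_le hab)
          _ = (b + 1).ascFactorial a * (m + 1 - a - 1)! := by
              rw [mul_assoc, sub_mul_factorial h1]; congr 2; omega
      · have h3 : countBelow S m = 0 := by omega
        rw [h1, h3, zero_add, Nat.one_ascFactorial]
        calc P * m ≤ (m - 1)! * m := by gcongr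
          _ = m ! := by rw [mul_comm]; exact Nat.mul_factorial_pred (by omega)
          _ = _ := by simp
    rw [if_neg hS, countBelow_succ_of_notMem hS]
    by_cases hU : m ∈ U
    · rw [if_pos hU, countBelow_succ_of_mem hU]
      rcases ih with ⟨h1, h2⟩ | ⟨h1, h2⟩
      · left
        refine ⟨by omega, ?_⟩
        calc _ ≤ _ := Nat.mul_le_mul_right _ h2
          _ = _ := by
            rw [Nat.ascFactorial_succ]
            have : m + 1 - (countBelow U m + 1) - 1 = m - countBelow U m - 1 := by omega
            rw [this]; ring
      · right
        refine ⟨by omega, ?_⟩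
        have h3 : countBelow S m = 0 := by omega
        calc _ ≤ _ := Nat.mul_le_mul_right _ h2
          _ = _ := by
            rw [h3, h1, zero_add, mul_comm, Nat.add_sub_cancel]
            exact Nat.mul_factorial_pred (by omega)
    · rw [if_neg hU, countBelow_succ_of_notMem hU]
      left
      refine ⟨by omega, ?_⟩
      rcases ih with ⟨h1, h2⟩ | ⟨h1, h2⟩
      · calc _ ≤ _ := Nat.mul_le_mul_right _ h2
          _ = _ := by
            rw [mul_assoc, mul_comm _ (m - countBelow U m), sub_mul_factorial h1]
            congr 2; omega
      · rw [h1]; simp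

/-- The analogue of `prod_encloses_le` when edges inside `U` are forbidden too. -/
theorem prod_isolates_le {U S : Finset ℕ} (hd : Disjoint U S) {m : ℕ} (hm : 1 ≤ m) :
    (countBelow U m < m ∧ ∏ j ∈ Ico 1 m, (if j ∈ S then j else if j ∈ U then
      countBelow S j else j - countBelow U j) ≤
        (countBelow S m) ^ (countBelow U m) * (m - countBelow U m - 1)!) ∨
    (countBelow U m = m ∧ ∏ j ∈ Ico 1 m, (if j ∈ S then j else if j ∈ U then
      countBelow S j else j - countBelow U j) ≤ 0 ^ (m - 1)) := by
  -- The same exception: if the first `m` vertices all lie in `U`, the product vanishes unless `m =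
  -- 1`, when it is empty.
  induction m, hm using Nat.le_induction with
  | base =>
    have h1 := countBelow_add_le hd 1
    rcases Nat.lt_or_ge (countBelow U 1) 1 with h | h
    · left
      refine ⟨h, ?_⟩
      have : countBelow U 1 = 0 := by omega
      simp [this]
    · right
      exact ⟨by omega, by simp⟩
  | succ m hm ih =>
    have hab := countBelow_add_le hd m
    rw [prod_Ico_succ_top hm]
    set P := ∏ j ∈ Ico 1 m, (if j ∈ S then j else if j ∈ U then
      countBelow S j else j - countBelow U j)
    by_cases hS : m ∈ S
    · have hU : m ∉ U := fun h => Finset.disjoint_left.1 hd h hS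
      rw [if_pos hS, countBelow_succ_of_mem hS, countBelow_succ_of_notMem hU]
      left
      refine ⟨by omega, ?_⟩
      rcases ih with ⟨h1, h2⟩ | ⟨h1, h2⟩
      · set a := countBelow U m
        set b := countBelow S m
        calc P * m ≤ (b ^ a * (m - a - 1)!) * m := by gcongr
          _ = (m * b ^ a) * (m - a - 1)! := by ring
          _ ≤ ((b + 1) ^ a * (m - a)) * (m - a - 1)! :=
              Nat.mul_le_mul_right _ (mul_pow_le hab)
          _ = (b + 1) ^ a * (m + 1 - a - 1)! := by
              rw [mul_assoc, sub_mul_factorial h1]; congr 2; omega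
      · have h3 : countBelow S m = 0 := by omega
        rw [h1, h3, zero_add, one_pow]
        calc P * m ≤ 0 ^ (m - 1) * m := by gcongr
          _ ≤ 1 := by
            rcases Nat.lt_or_ge 1 m with h | h
            · rw [zero_pow (by omega)]; simp
            · have : m = 1 := by omega
              simp [this]
          _ = _ := by simp
    rw [if_neg hS, countBelow_succ_of_notMem hS]
    by_cases hU : m ∈ U
    · rw [if_pos hU, countBelow_succ_of_mem hU]
      rcases ih with ⟨h1, h2⟩ | ⟨h1, h2⟩
      · left
        refine ⟨by omega, ?_⟩
        calc _ ≤ _ := Nat.mul_le_mul_right _ h2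
          _ = _ := by
            have : m + 1 - (countBelow U m + 1) - 1 = m - countBelow U m - 1 := by omega
            rw [this]; ring
      · right
        refine ⟨by omega, ?_⟩
        have h3 : countBelow S m = 0 := by omega
        rw [h3]; simp
    · rw [if_neg hU, countBelow_succ_of_notMem hU]
      left
      refine ⟨by omega, ?_⟩
      rcases ih with ⟨h1, h2⟩ | ⟨h1, h2⟩
      · calc _ ≤ _ := Nat.mul_le_mul_right _ h2
          _ = _ := by
            rw [mul_assoc, mul_comm _ (m - countBelow U m), sub_mul_factorial h1]
            congr 2; omega
      · rw [h1]; simp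

theorem graph_adj_choice {n k : ℕ} (c : Choices n k) (p : Chooser n × Fin k) :
    (graph c).Adj p.1.1 ⟨c p, (c p).2.trans p.1.1.2⟩ := by
  rw [graph, SimpleGraph.fromRel_adj]
  refine ⟨?_, Or.inl ⟨p.1.2, p.2, rfl⟩⟩
  intro h
  have := congrArg Fin.val h
  exact (c p).2.ne' this

theorem graph_adj_iff {n k : ℕ} {c : Choices n k} {u v : Fin n} :
    (graph c).Adj u v ↔ ∃ p : Chooser n × Fin k,
      (p.1.1 = u ∧ (c p : ℕ) = v) ∨ (p.1.1 = v ∧ (c p : ℕ) = u) := by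
  constructor
  · rw [graph, SimpleGraph.fromRel_adj]
    rintro ⟨-, ⟨h, r, hr⟩ | ⟨h, r, hr⟩⟩
    · exact ⟨(⟨u, h⟩, r), Or.inl ⟨rfl, hr⟩⟩
    · exact ⟨(⟨v, h⟩, r), Or.inr ⟨rfl, hr⟩⟩
  · rintro ⟨p, ⟨rfl, h⟩ | ⟨rfl, h⟩⟩
    · convert graph_adj_choice c p using 1; exact Fin.ext h.symm
    · convert (graph_adj_choice c p).symm using 1; exact Fin.ext h.symm

section

variable {n : ℕ} (U S : Finset (Fin n))

theorem countBelow_map_top : countBelow (U.map Fin.valEmbedding) n = U.card := by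
  unfold countBelow
  rw [filter_true_of_mem, card_map]
  intro x hx
  obtain ⟨y, -, rfl⟩ := mem_map.1 hx
  exact y.2

theorem card_filter_range_sdiff (U : Finset ℕ) {j n : ℕ} (hj : j ≤ n) :
    ((range n \ U).filter (· < j)).card = j - countBelow U j := by
  have h : (range n \ U).filter (· < j) = range j \ U.filter (· < j) := by
    ext x; simp only [mem_filter, mem_sdiff, mem_range]; constructor
    · rintro ⟨⟨h1, h2⟩, h3⟩; exact ⟨h3, fun h => h2 h.1⟩
    · rintro ⟨h1, h2⟩; exact ⟨⟨by omega, fun h => h2 ⟨h, h1⟩⟩, h1⟩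
  rw [h, card_sdiff_of_subset, card_range]
  · rfl
  · intro x hx; rw [mem_range]; exact (mem_filter.1 hx).2

theorem card_filter_range {j n : ℕ} (hj : j ≤ n) :
    ((range n).filter (· < j)).card = j := by
  simpa [countBelow] using card_filter_range_sdiff ∅ hj

theorem prod_div_eq {f : ℕ → ℕ} (hn : 1 ≤ n) :
    ∏ j ∈ Ico 1 n, (f j : ℝ) / (j : ℝ) = ((∏ j ∈ Ico 1 n, f j : ℕ) : ℝ) / ((n - 1)! : ℝ) := by
  rw [prod_div_distrib]
  congr 1
  · push_cast; rfl
  · obtain ⟨m, rfl⟩ := Nat.exists_eq_add_of_le' hn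
    rw [Nat.add_sub_cancel, ← prod_Ico_id_eq_factorial]
    push_cast; rfl

variable {U S}

/-- Vertices of S choose freely, those of U must choose in U ∪ S, and all others must avoid U.
Nonemptiness of S gives |U| < n, which rules out the exceptional alternative of `prod_encloses_le`.
-/
theorem choiceLaw_real_encloses_le {k : ℕ} (hd : Disjoint U S) (hS : S.Nonempty) :
    (choiceLaw n k).real {c | Encloses (graph c) U S} ≤
      (((S.card.ascFactorial U.card * (n - U.card - 1)! : ℕ) : ℝ) / ((n - 1)! : ℝ)) ^ k := by
  have hn : 1 ≤ n := by obtain ⟨x, -⟩ := hS; have := x.2; omega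
  set U' := U.map Fin.valEmbedding with hU'
  set S' := S.map Fin.valEmbedding with hS'
  have memU : ∀ x : Fin n, (x : ℕ) ∈ U' ↔ x ∈ U := fun x => mem_map' Fin.valEmbedding
  have memS : ∀ x : Fin n, (x : ℕ) ∈ S' ↔ x ∈ S := fun x => mem_map' Fin.valEmbedding
  have hd' : Disjoint U' S' := (disjoint_map _).2 hd
  set A : ℕ → Finset ℕ := fun j =>
    if j ∈ S' then range n else if j ∈ U' then S' ∪ U' else range n \ U' with hA
  have hsub : {c : Choices n k | Encloses (graph c) U S} ⊆ {c | ∀ p, (c p : ℕ) ∈ A p.1.1} := by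
    intro c hc p
    have hadj := graph_adj_choice c p
    have hlt : (c p : ℕ) < n := (c p).2.trans p.1.1.2
    simp only [hA]
    split_ifs with h1 h2
    · exact mem_range.2 hlt
    · rcases hc _ ((memU _).1 h2) _ hadj with h | h
      · exact mem_union_right _ ((memU _).2 h)
      · exact mem_union_left _ ((memS _).2 h)
    · refine mem_sdiff.2 ⟨mem_range.2 hlt, fun h => ?_⟩
      rcases hc _ ((memU ⟨c p, hlt⟩).1 h) _ hadj.symm with h | h
      · exact h2 ((memU _).2 h)
      · exact h1 ((memS _).2 h)
  have hcard : ∀ j ∈ Ico 1 n, (((A j).filter (· < j)).card : ℝ) / (j : ℝ) =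
      ((if j ∈ S' then j else if j ∈ U' then
      countBelow S' j + countBelow U' j else j - countBelow U' j : ℕ) : ℝ) / (j : ℝ) := by
    intro j hj
    rw [mem_Ico] at hj
    congr 2
    simp only [hA]
    split_ifs with h1 h2
    · exact card_filter_range hj.2.le
    · rw [filter_union, card_union_of_disjoint (disjoint_filter_filter hd'.symm)]; rfl
    · exact card_filter_range_sdiff _ hj.2.le
  refine (measureReal_mono hsub).trans ?_
  rw [choiceLaw_real_forall_mem, prod_congr rfl hcard, prod_div_eq hn]
  have hcU : countBelow U' n = U.card := countBelow_map_top U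
  have hcS : countBelow S' n = S.card := countBelow_map_top S
  have key := prod_encloses_le hd' hn
  have hpos := card_pos.2 hS
  have hle := countBelow_add_le hd' n
  rw [hcU, hcS] at *
  rcases key with ⟨-, key⟩ | ⟨h, -⟩
  · gcongr
  · omega

theorem choiceLaw_real_isolates_le {k : ℕ} (hd : Disjoint U S) (hS : S.Nonempty) :
    (choiceLaw n k).real {c | Isolates (graph c) U S} ≤
      (((S.card ^ U.card * (n - U.card - 1)! : ℕ) : ℝ) / ((n - 1)! : ℝ)) ^ k := by
  have hn : 1 ≤ n := by obtain ⟨x, -⟩ := hS; have := x.2; omega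
  set U' := U.map Fin.valEmbedding with hU'
  set S' := S.map Fin.valEmbedding with hS'
  have memU : ∀ x : Fin n, (x : ℕ) ∈ U' ↔ x ∈ U := fun x => mem_map' Fin.valEmbedding
  have memS : ∀ x : Fin n, (x : ℕ) ∈ S' ↔ x ∈ S := fun x => mem_map' Fin.valEmbedding
  have hd' : Disjoint U' S' := (disjoint_map _).2 hd
  set A : ℕ → Finset ℕ := fun j =>
    if j ∈ S' then range n else if j ∈ U' then S' else range n \ U' with hA
  have hsub : {c : Choices n k | Isolates (graph c) U S} ⊆ {c | ∀ p, (c p : ℕ) ∈ A p.1.1} := by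
    intro c hc p
    have hadj := graph_adj_choice c p
    have hlt : (c p : ℕ) < n := (c p).2.trans p.1.1.2
    simp only [hA]
    split_ifs with h1 h2
    · exact mem_range.2 hlt
    · exact (memS _).2 (hc _ ((memU _).1 h2) _ hadj)
    · refine mem_sdiff.2 ⟨mem_range.2 hlt, fun h => ?_⟩
      exact h1 ((memS _).2 (hc _ ((memU ⟨c p, hlt⟩).1 h) _ hadj.symm))
  have hcard : ∀ j ∈ Ico 1 n, (((A j).filter (· < j)).card : ℝ) / (j : ℝ) =
      ((if j ∈ S' then j else if j ∈ U' then
      countBelow S' j else j - countBelow U' j : ℕ) : ℝ) / (j : ℝ) := by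
    intro j hj
    rw [mem_Ico] at hj
    congr 2
    simp only [hA]
    split_ifs with h1 h2
    · exact card_filter_range hj.2.le
    · rfl
    · exact card_filter_range_sdiff _ hj.2.le
  refine (measureReal_mono hsub).trans ?_
  rw [choiceLaw_real_forall_mem, prod_congr rfl hcard, prod_div_eq hn]
  have hcU : countBelow U' n = U.card := countBelow_map_top U
  have hcS : countBelow S' n = S.card := countBelow_map_top S
  have key := prod_isolates_le hd' hn
  have hpos := card_pos.2 hS
  have hle := countBelow_add_le hd' n
  rw [hcU, hcS] at *
  rcases key with ⟨-, key⟩ | ⟨h, -⟩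
  · gcongr
  · omega

end

end UniformAttachment

/-! ### Disjoint families of sets of inner degree two. -/

namespace UniformAttachment

open Finset MeasureTheory

/-- Markov's inequality for the number of events that occur. -/
theorem mul_measureReal_le_card_filter_le {Ω ι : Type*} [Finite Ω] [MeasurableSpace Ω]
    [MeasurableSingletonClass Ω] [DecidableEq ι] (μ : Measure Ω) [IsFiniteMeasure μ]
    (s : Finset ι) (P : ι → Ω → Prop) [∀ i ω, Decidable (P i ω)] (m : ℕ) :
    m * μ.real {ω | m ≤ (s.filter fun i => P i ω).card} ≤ ∑ i ∈ s, μ.real {ω | P i ω} := by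
  have h := mul_meas_ge_le_integral_of_nonneg (μ := μ)
    (f := fun ω => ((s.filter fun i => P i ω).card : ℝ))
    (Filter.Eventually.of_forall fun ω => by positivity) Integrable.of_finite (m : ℝ)
  simp only [Nat.cast_le] at h
  refine h.trans (le_of_eq ?_)
  have h2 : ∀ ω, ((s.filter fun i => P i ω).card : ℝ) =
      ∑ i ∈ s, Set.indicator {ω | P i ω} (fun _ => (1 : ℝ)) ω := by
    intro ω
    rw [card_filter]
    push_cast
    refine sum_congr rfl fun i _ => ?_
    by_cases hi : P i ω <;> simp [hi]
  simp only [h2]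
  rw [integral_finsetSum _ fun i _ => Integrable.of_finite]
  refine sum_congr rfl fun i _ => ?_
  rw [integral_indicator (Set.toFinite _).measurableSet]
  simp

/-- The vertex selected by the choice `p`. -/
def target {n k : ℕ} (c : Choices n k) (p : Chooser n × Fin k) : Fin n :=
  ⟨c p, (c p).2.trans p.1.1.2⟩

/-- There are at least 2|C| ordered adjacent pairs inside C, and each inner choice accounts for at
most two of them. -/
theorem card_le_card_inner_choices {n k : ℕ} {c : Choices n k} {C : Finset (Fin n)}
    (hC : HasInnerDegreeTwo (graph c) C) :
    C.card ≤ (univ.filter fun p : Chooser n × Fin k => p.1.1 ∈ C ∧ target c p ∈ C).card := by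
  classical
  set s := univ.filter fun p : Chooser n × Fin k => p.1.1 ∈ C ∧ target c p ∈ C with hs
  set O := C.sigma fun v => C.filter fun w => (graph c).Adj v w with hO
  have h1 : 2 * C.card ≤ O.card := by
    rw [hO, card_sigma, mul_comm, ← smul_eq_mul]
    refine card_nsmul_le_sum _ _ _ fun v hv => ?_
    obtain ⟨x, hx, y, hy, hxy, hvx, hvy⟩ := hC v hv
    rw [← card_pair hxy]
    refine card_le_card fun z hz => ?_
    rcases mem_insert.1 hz with rfl | hz
    · exact mem_filter.2 ⟨hx, hvx⟩
    · rw [mem_singleton] at hz; subst hz; exact mem_filter.2 ⟨hy, hvy⟩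
  have h2 : O ⊆ (s.image fun p => (⟨p.1.1, target c p⟩ : (_ : Fin n) × Fin n)) ∪
      s.image fun p => (⟨target c p, p.1.1⟩ : (_ : Fin n) × Fin n) := by
    rintro ⟨v, w⟩ hvw
    simp only [hO, mem_sigma, mem_filter] at hvw
    obtain ⟨hv, hw, hadj⟩ := hvw
    obtain ⟨p, ⟨e1, e2⟩ | ⟨e1, e2⟩⟩ := graph_adj_iff.1 hadj
    · have e3 : target c p = w := Fin.ext e2
      refine mem_union_left _ (mem_image.2 ⟨p, ?_, by rw [e1, e3]⟩)
      simp [hs, e1, e3, hv, hw]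
    · have e3 : target c p = v := Fin.ext e2
      refine mem_union_right _ (mem_image.2 ⟨p, ?_, by rw [e1, e3]⟩)
      simp [hs, e1, e3, hv, hw]
  have h3 := card_le_card h2
  have h4 := card_union_le (s.image fun p => (⟨p.1.1, target c p⟩ : (_ : Fin n) × Fin n))
    (s.image fun p => (⟨target c p, p.1.1⟩ : (_ : Fin n) × Fin n))
  have h5 := card_image_le (s := s) (f := fun p => (⟨p.1.1, target c p⟩ : (_ : Fin n) × Fin n))
  have h6 := card_image_le (s := s) (f := fun p => (⟨target c p, p.1.1⟩ : (_ : Fin n) × Fin n))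
  omega

theorem choiceLaw_real_forall_target_mem_le {n k : ℕ} {C : Finset (Fin n)} {e : ℕ} (he : 1 ≤ e)
    (hC : ∀ v ∈ C, e ≤ (v : ℕ)) (F : Finset (Chooser n × Fin k)) (hF : ∀ p ∈ F, p.1.1 ∈ C) :
    (choiceLaw n k).real {c | ∀ p ∈ F, target c p ∈ C} ≤ ((C.card : ℝ) / e) ^ F.card := by
  classical
  have h : {c : Choices n k | ∀ p ∈ F, target c p ∈ C} = {c | ∀ p, c p ∈
      univ.filter fun x : Fin (p.1.1 : ℕ) => p ∈ F → (⟨x, x.2.trans p.1.1.2⟩ : Fin n) ∈ C} := by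
    ext c; simp [target]
  rw [h, choiceLaw_real_box, ← prod_const, ← prod_subset (subset_univ F)]
  · refine prod_le_prod (fun p _ => by positivity) fun p hp => ?_
    have h1 : (univ.filter fun x : Fin (p.1.1 : ℕ) =>
        p ∈ F → (⟨x, x.2.trans p.1.1.2⟩ : Fin n) ∈ C).card ≤ C.card := by
      refine card_le_card_of_injOn (fun x => (⟨x, x.2.trans p.1.1.2⟩ : Fin n)) ?_ ?_
      · intro x hx
        simp only [coe_filter, mem_univ, true_and, Set.mem_ofPred_eq] at hx
        exact hx hp
      · intro x _ y _ hxy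
        exact Fin.ext (congrArg (fun z : Fin n => (z : ℕ)) hxy)
    have h2 : e ≤ (p.1.1 : ℕ) := hC _ (hF p hp)
    gcongr
  · intro p _ hp
    have : ((p.1.1 : ℕ) : ℝ) ≠ 0 := by
      have := p.1.2; positivity
    simp [hp, this]

/-- Union bound over which |C| of the at most k|C| choices made in C stay inside: they do so
independently, each with probability at most |C|/e. -/
theorem choiceLaw_real_hasInnerDegreeTwo_le {n k : ℕ} {C : Finset (Fin n)} {e : ℕ} (he : 1 ≤ e)
    (hC : ∀ v ∈ C, e ≤ (v : ℕ)) :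
    (choiceLaw n k).real {c | HasInnerDegreeTwo (graph c) C} ≤
      (2 ^ k * ((C.card : ℝ) / e)) ^ C.card := by
  classical
  set s := univ.filter fun p : Chooser n × Fin k => p.1.1 ∈ C with hs
  have hscard : s.card ≤ k * C.card := by
    calc s.card ≤ (C ×ˢ (univ : Finset (Fin k))).card := by
          refine card_le_card_of_injOn (fun p => (p.1.1, p.2)) ?_ ?_
          · intro p hp
            simp only [hs, coe_filter, mem_univ, true_and, Set.mem_ofPred_eq] at hp
            simp [hp]
          · intro p _ q _ hpq
            simp only [Prod.mk.injEq] at hpq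
            exact Prod.ext (Subtype.ext hpq.1) hpq.2
      _ = k * C.card := by rw [card_product, card_univ, Fintype.card_fin, mul_comm]
  have hsub : {c : Choices n k | HasInnerDegreeTwo (graph c) C} ⊆
      ⋃ F ∈ powersetCard C.card s, {c | ∀ p ∈ F, target c p ∈ C} := by
    intro c hc
    obtain ⟨F, hF, hFc⟩ := exists_subset_card_eq (card_le_card_inner_choices hc)
    simp only [Set.mem_iUnion]
    refine ⟨F, mem_powersetCard.2 ⟨fun p hp => ?_, hFc⟩, fun p hp => ?_⟩
    · have := mem_filter.1 (hF hp)
      exact mem_filter.2 ⟨mem_univ _, this.2.1⟩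
    · exact (mem_filter.1 (hF hp)).2.2
  calc _ ≤ (choiceLaw n k).real _ := measureReal_mono hsub (measure_ne_top _ _)
    _ ≤ ∑ F ∈ powersetCard C.card s, (choiceLaw n k).real {c | ∀ p ∈ F, target c p ∈ C} :=
        measureReal_biUnion_finset_le _ _
    _ ≤ ∑ F ∈ powersetCard C.card s, ((C.card : ℝ) / e) ^ C.card := by
        refine sum_le_sum fun F hF => ?_
        obtain ⟨h1, h2⟩ := mem_powersetCard.1 hF
        have h3 := choiceLaw_real_forall_target_mem_le he hC F
          fun p hp => (mem_filter.1 (h1 hp)).2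
        rwa [h2] at h3
    _ = (s.card.choose C.card : ℝ) * ((C.card : ℝ) / e) ^ C.card := by
        rw [sum_const, card_powersetCard, nsmul_eq_mul]
    _ ≤ (2 ^ k) ^ C.card * ((C.card : ℝ) / e) ^ C.card := by
        gcongr
        calc (s.card.choose C.card : ℝ) ≤ (2 ^ s.card : ℕ) := by
              exact_mod_cast Nat.choose_le_two_pow _ _
          _ ≤ (2 ^ (k * C.card) : ℕ) := by
              exact_mod_cast Nat.pow_le_pow_right (by norm_num) hscard
          _ = (2 ^ k) ^ C.card := by push_cast; rw [pow_mul]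
    _ = _ := by rw [← mul_pow]

/-- There are at most n^r ≤ (Me)^r sets of size r, so the powers of e cancel and the expected number
is bounded independently of n. -/
theorem sum_choiceLaw_real_hasInnerDegreeTwo_le {n k e K M : ℕ} (he : 1 ≤ e) (hM : n ≤ M * e)
    (s : Finset (Finset (Fin n))) (hs : ∀ C ∈ s, C.card < K ∧ ∀ v ∈ C, e ≤ (v : ℕ)) :
    ∑ C ∈ s, (choiceLaw n k).real {c | HasInnerDegreeTwo (graph c) C} ≤
      ∑ r ∈ range K, ((M : ℝ) * 2 ^ k * r) ^ r := by
  classical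
  calc _ ≤ ∑ C ∈ s, (2 ^ k * ((C.card : ℝ) / e)) ^ C.card :=
        sum_le_sum fun C hC => choiceLaw_real_hasInnerDegreeTwo_le he (hs C hC).2
    _ = ∑ r ∈ range K, ∑ C ∈ s with C.card = r, (2 ^ k * ((C.card : ℝ) / e)) ^ C.card :=
        (sum_fiberwise_of_maps_to (fun C hC => mem_range.2 (hs C hC).1) _).symm
    _ ≤ ∑ r ∈ range K, ((M : ℝ) * 2 ^ k * r) ^ r := by
        refine sum_le_sum fun r _ => ?_
        have he' : (0 : ℝ) < e := by exact_mod_cast he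
        calc _ = ∑ C ∈ s with C.card = r, (2 ^ k * ((r : ℝ) / e)) ^ r :=
              sum_congr rfl fun C hC => by rw [(mem_filter.1 hC).2]
          _ = ((s.filter fun C => C.card = r).card : ℝ) * (2 ^ k * ((r : ℝ) / e)) ^ r := by
              rw [sum_const, nsmul_eq_mul]
          _ ≤ ((M : ℝ) * e) ^ r * (2 ^ k * ((r : ℝ) / e)) ^ r := by
              gcongr
              have h1 : (s.filter fun C => C.card = r).card ≤ (M * e) ^ r := by
                calc _ ≤ (powersetCard r (univ : Finset (Fin n))).card :=
                      card_le_card fun C hC =>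
                        mem_powersetCard.2 ⟨subset_univ _, (mem_filter.1 hC).2⟩
                  _ = n.choose r := by rw [card_powersetCard, card_univ, Fintype.card_fin]
                  _ ≤ n ^ r := Nat.choose_le_pow _ _
                  _ ≤ _ := Nat.pow_le_pow_left hM r
              exact_mod_cast h1
          _ = _ := by rw [← mul_pow]; congr 1; field_simp

/-- Disjoint sets of inner degree two: few of them are large, few of them contain an early vertex,
and the others are counted one by one. -/
theorem card_family_le {n K e : ℕ} (hK : 0 < K) (F : Finset (Finset (Fin n)))
    (hF : (F : Set (Finset (Fin n))).PairwiseDisjoint id) :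
    F.card ≤ n / K + e + (F.filter fun C => C.card < K ∧ ∀ v : Fin n, v ∈ C → e ≤ (v : ℕ)).card := by
  classical
  set F₁ := F.filter fun C => K ≤ C.card with hF₁
  set F₂ := F.filter fun C => ∃ v : Fin n, v ∈ C ∧ (v : ℕ) < e with hF₂
  have hsub : F ⊆ (F₁ ∪ F₂) ∪ F.filter fun C => C.card < K ∧ ∀ v : Fin n, v ∈ C → e ≤ (v : ℕ) := by
    intro C hC
    simp only [hF₁, hF₂, mem_union, mem_filter, hC, true_and]
    by_cases h1 : K ≤ C.card
    · exact Or.inl (Or.inl h1)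
    · by_cases h2 : ∃ v : Fin n, v ∈ C ∧ (v : ℕ) < e
      · exact Or.inl (Or.inr h2)
      · push Not at h1 h2
        exact Or.inr ⟨h1, h2⟩
  have hdis : ∀ F' : Finset (Finset (Fin n)), F' ⊆ F →
      (F' : Set (Finset (Fin n))).PairwiseDisjoint id :=
    fun F' h => hF.subset (by exact_mod_cast h)
  have h1 : F₁.card ≤ n / K := by
    rw [Nat.le_div_iff_mul_le hK]
    calc F₁.card * K ≤ ∑ C ∈ F₁, C.card := by
          rw [← smul_eq_mul]
          exact card_nsmul_le_sum _ _ _ fun C hC => (mem_filter.1 hC).2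
      _ = (F₁.biUnion id).card := (card_biUnion (hdis F₁ (filter_subset _ _))).symm
      _ ≤ n := by simpa using card_le_univ (F₁.biUnion id)
  have h2 : F₂.card ≤ e := by
    rcases F₂.eq_empty_or_nonempty with h | ⟨C₀, hC₀⟩
    · simp [h]
    have hne : ∀ C ∈ F₂, ∃ v : Fin n, v ∈ C ∧ (v : ℕ) < e := fun C hC => (mem_filter.1 hC).2
    have : Nonempty (Fin n) := (hne C₀ hC₀).nonempty
    choose! f hf hfe using hne
    calc F₂.card ≤ (range e).card := by
          refine card_le_card_of_injOn (fun C => (f C : ℕ)) ?_ ?_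
          · intro C hC; simpa using hfe C hC
          · intro C hC B hB hCB
            by_contra hne
            have hd := hdis F₂ (filter_subset _ _) hC hB hne
            have : f C = f B := Fin.ext hCB
            exact Finset.disjoint_left.1 hd (hf C hC) (this ▸ hf B hB)
      _ = e := card_range e
  have h3 := card_le_card hsub
  have h4 := card_union_le (F₁ ∪ F₂)
    (F.filter fun C => C.card < K ∧ ∀ v : Fin n, v ∈ C → e ≤ (v : ℕ))
  have h5 := card_union_le F₁ F₂
  omega

theorem choiceLaw_real_exists_family_le {n k D : ℕ} (hn : D ≤ n) (hD : 1 ≤ D) :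
    (choiceLaw n k).real {c | ∃ F : Finset (Finset (Fin n)),
      (F : Set (Finset (Fin n))).PairwiseDisjoint id ∧ 3 * (n / D) < F.card ∧
      ∀ C ∈ F, C.Nonempty ∧ HasInnerDegreeTwo (graph c) C} ≤
    (∑ r ∈ range D, (((2 * D : ℕ) : ℝ) * 2 ^ k * r) ^ r) / ((n / D : ℕ) : ℝ) := by
  classical
  have he : 1 ≤ n / D := (Nat.one_le_div_iff hD).2 hn
  set e := n / D with hedef
  have hM : n ≤ (2 * D) * e := by
    have h1 := Nat.lt_mul_div_succ n (show 0 < D from hD)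
    rw [← hedef] at h1
    nlinarith
  set s := (univ : Finset (Finset (Fin n))).filter
    fun C => C.card < D ∧ ∀ v : Fin n, v ∈ C → e ≤ (v : ℕ) with hs
  have h1 := sum_choiceLaw_real_hasInnerDegreeTwo_le (k := k) he hM s
    (fun C hC => (mem_filter.1 hC).2)
  have h2 := mul_measureReal_le_card_filter_le (choiceLaw n k) s
    (fun C c => HasInnerDegreeTwo (graph c) C) e
  have he' : (0 : ℝ) < e := by exact_mod_cast he
  rw [le_div_iff₀' he']
  refine le_trans ?_ (h2.trans h1)
  refine mul_le_mul_of_nonneg_left (measureReal_mono ?_ (measure_ne_top _ _)) he'.le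
  intro c hc
  obtain ⟨F, hF, hcard, hFC⟩ := hc
  -- Of the three shares `n / D`, one covers the large sets and one those with an early vertex; the
  -- surplus over these exceeds `e`, the level used in Markov's inequality.
  have h3 := card_family_le (K := D) (e := e) hD F hF
  have h4 : (F.filter fun C => C.card < D ∧ ∀ v : Fin n, v ∈ C → e ≤ (v : ℕ)).card ≤
      (s.filter fun C => HasInnerDegreeTwo (graph c) C).card := by
    refine card_le_card fun C hC => ?_
    rw [mem_filter] at hC
    exact mem_filter.2 ⟨mem_filter.2 ⟨mem_univ _, hC.2⟩, (hFC C hC.1).2⟩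
  rw [Set.mem_ofPred_eq]
  omega

end UniformAttachment

/-! ### Union bounds for enclosed sets. -/

namespace UniformAttachment

open Finset MeasureTheory
open scoped Nat

theorem choiceLaw_real_exists_pair_le {n k : ℕ}
    (Q : Choices n k → Finset (Fin n) → Finset (Fin n) → Prop) (u s : ℕ) (B : ℝ)
    (hB : ∀ U S, Disjoint U S → U.card = u → S.card = s →
      (choiceLaw n k).real {c | Q c U S} ≤ B) :
    (choiceLaw n k).real {c | ∃ U S, Disjoint U S ∧ U.card = u ∧ S.card = s ∧ Q c U S} ≤
      (n.choose u : ℝ) * ((n - u).choose s : ℝ) * B := by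
  have hsub : {c : Choices n k | ∃ U S, Disjoint U S ∧ U.card = u ∧ S.card = s ∧ Q c U S} ⊆
      ⋃ U ∈ powersetCard u (univ : Finset (Fin n)), ⋃ S ∈ powersetCard s Uᶜ, {c | Q c U S} := by
    rintro c ⟨U, S, hd, hU, hS, h⟩
    simp only [Set.mem_iUnion]
    exact ⟨U, mem_powersetCard.2 ⟨subset_univ _, hU⟩, S,
      mem_powersetCard.2 ⟨by rwa [subset_compl_iff_disjoint_left], hS⟩, h⟩
  calc _ ≤ (choiceLaw n k).real _ := measureReal_mono hsub (measure_ne_top _ _)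
    _ ≤ ∑ U ∈ powersetCard u (univ : Finset (Fin n)),
        (choiceLaw n k).real (⋃ S ∈ powersetCard s Uᶜ, {c | Q c U S}) :=
        measureReal_biUnion_finset_le _ _
    _ ≤ ∑ U ∈ powersetCard u (univ : Finset (Fin n)), ((n - u).choose s : ℝ) * B := by
        refine sum_le_sum fun U hU => ?_
        have hUc := (mem_powersetCard.1 hU).2
        calc _ ≤ ∑ S ∈ powersetCard s Uᶜ, (choiceLaw n k).real {c | Q c U S} :=
              measureReal_biUnion_finset_le _ _
          _ ≤ ∑ S ∈ powersetCard s Uᶜ, B := by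
              refine sum_le_sum fun S hS => ?_
              obtain ⟨h1, h2⟩ := mem_powersetCard.1 hS
              exact hB U S (by rwa [← subset_compl_iff_disjoint_left]) hUc h2
          _ = _ := by
              rw [sum_const, card_powersetCard, card_compl, hUc, Fintype.card_fin, nsmul_eq_mul]
    _ = _ := by
        rw [sum_const, card_powersetCard, card_univ, Fintype.card_fin, nsmul_eq_mul, mul_assoc]

/-- As a ratio of binomial coefficients, the probability bound compares directly with the number of
sets U. -/
theorem ascFactorial_mul_factorial_div {n u s : ℕ} (h : u < n) :
    ((s.ascFactorial u * (n - u - 1)! : ℕ) : ℝ) / ((n - 1)! : ℝ) =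
      ((s + u - 1).choose u : ℝ) / ((n - 1).choose u : ℝ) := by
  have h1 : (n - 1).choose u * u ! * (n - u - 1)! = (n - 1)! := by
    have := Nat.choose_mul_factorial_mul_factorial (show u ≤ n - 1 by omega)
    rwa [show n - 1 - u = n - u - 1 by omega] at this
  have h2 : 0 < (n - 1).choose u := Nat.choose_pos (by omega)
  rw [Nat.ascFactorial_eq_factorial_mul_choose', ← h1, div_eq_div_iff]
  · push_cast; ring
  · positivity
  · positivity

theorem pow_le_pow_mul_choose {n u : ℕ} (h : u ≤ n) : n ^ u ≤ u ^ u * n.choose u := by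
  induction u generalizing n with
  | zero => simp
  | succ u ih =>
    obtain ⟨n, rfl⟩ := Nat.exists_eq_add_of_le' (show 1 ≤ n by omega)
    have key : (n + 1) ^ u ≤ (u + 1) ^ u * n.choose u := by
      rcases Nat.eq_zero_or_pos u with rfl | hu
      · simp
      · refine Nat.le_of_mul_le_mul_left ?_ (Nat.pow_pos hu (n := u))
        calc u ^ u * (n + 1) ^ u = (u * (n + 1)) ^ u := by rw [mul_pow]
          _ ≤ (n * (u + 1)) ^ u := Nat.pow_le_pow_left (by nlinarith) _
          _ = n ^ u * (u + 1) ^ u := by rw [mul_pow]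
          _ ≤ (u ^ u * n.choose u) * (u + 1) ^ u := Nat.mul_le_mul_right _ (ih (by omega))
          _ = _ := by ring
    calc (n + 1) ^ (u + 1) = (n + 1) * (n + 1) ^ u := by ring
      _ ≤ (n + 1) * ((u + 1) ^ u * n.choose u) := Nat.mul_le_mul_left _ key
      _ = (u + 1) ^ u * ((n + 1) * n.choose u) := by ring
      _ = _ := by rw [Nat.add_one_mul_choose_eq]; ring

theorem choose_le_two_mul_choose_pred {n u : ℕ} (hn : 1 ≤ n) (h : 2 * u ≤ n) :
    n.choose u ≤ 2 * (n - 1).choose u := by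
  obtain ⟨n, rfl⟩ := Nat.exists_eq_add_of_le' hn
  have h1 := Nat.choose_mul_succ_eq n u
  rw [Nat.add_sub_cancel]
  refine Nat.le_of_mul_le_mul_right ?_ (show 0 < n + 1 by omega)
  calc (n + 1).choose u * (n + 1) ≤ (n + 1).choose u * (2 * (n + 1 - u)) :=
        Nat.mul_le_mul_left _ (by omega)
    _ = 2 * ((n + 1).choose u * (n + 1 - u)) := by ring
    _ = _ := by rw [← h1]; ring

theorem choose_mul_pow_le {a b : ℕ} {p : ℝ} (hp : 0 ≤ p) (h : b ≤ a) :
    (a.choose b : ℝ) * p ^ b ≤ (1 + p) ^ a := by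
  rw [add_comm, add_pow]
  refine le_trans (le_of_eq ?_) (single_le_sum (f := fun m => p ^ m * 1 ^ (a - m) * (a.choose m : ℝ))
    (fun i _ => by positivity) (mem_range.2 (Nat.lt_succ_of_le h)))
  simp [mul_comm]

/-- With C = binom(n-1, u), the pairs cost at most (2C)² and the five choices gain C⁻⁵. The
remaining C⁻³ beats 4^(5u) = 1024^u, since C ≥ ((n-1)/u)^u. The bound is uniform in u, so summing
over u loses only a factor n. -/
theorem choiceLaw_real_encloses_same_card_le {n u : ℕ} (hu : 1 ≤ u) (h : 24 * u ≤ n) :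
    (choiceLaw n 5).real {c | ∃ U S, Disjoint U S ∧ U.card = u ∧ S.card = u ∧
      Encloses (graph c) U S} ≤ 32768 / ((n : ℝ) - 1) ^ 3 := by
  have h1 := choiceLaw_real_exists_pair_le (n := n) (k := 5) (fun c U S => Encloses (graph c) U S)
    u u ((((u + u - 1).choose u : ℝ) / ((n - 1).choose u : ℝ)) ^ 5) (by
      intro U S hd hU hS
      have := choiceLaw_real_encloses_le (k := 5) hd (card_pos.1 (by omega))
      rwa [hU, hS, ascFactorial_mul_factorial_div (by omega)] at this)
  refine h1.trans ?_
  have hy : (0 : ℝ) < (n : ℝ) - 1 := by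
    have : (24 : ℝ) ≤ n := by exact_mod_cast (by omega : 24 ≤ n)
    linarith
  set C := ((n - 1).choose u : ℝ) with hC
  have hCpos : 0 < C := by
    rw [hC]; exact_mod_cast Nat.choose_pos (show u ≤ n - 1 by omega)
  have hu' : (0 : ℝ) < u := by exact_mod_cast hu
  have e1 : (n.choose u : ℝ) ≤ 2 * C := by
    rw [hC]; exact_mod_cast choose_le_two_mul_choose_pred (n := n) (u := u) (by omega) (by omega)
  have e2 : ((n - u).choose u : ℝ) ≤ 2 * C :=
    le_trans (by exact_mod_cast Nat.choose_le_choose u (Nat.sub_le n u)) e1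
  have e3 : ((u + u - 1).choose u : ℝ) ≤ 4 ^ u := by
    calc ((u + u - 1).choose u : ℝ) ≤ (2 ^ (u + u - 1) : ℕ) := by
          exact_mod_cast Nat.choose_le_two_pow _ _
      _ ≤ (2 ^ (2 * u) : ℕ) := by exact_mod_cast Nat.pow_le_pow_right (by norm_num) (by omega)
      _ = 4 ^ u := by rw [pow_mul]; norm_num
  have e4 : (((n : ℝ) - 1) / u) ^ u ≤ C := by
    have := pow_le_pow_mul_choose (show u ≤ n - 1 by omega)
    rw [div_pow, div_le_iff₀ (by positivity), mul_comm]
    calc ((n : ℝ) - 1) ^ u = (((n - 1) ^ u : ℕ) : ℝ) := by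
          rw [Nat.cast_pow, Nat.cast_sub (by omega)]; simp
      _ ≤ _ := by rw [hC]; exact_mod_cast this
  have e5 : (u : ℝ) / ((n : ℝ) - 1) ≤ 1 / 23 := by
    rw [div_le_div_iff₀ hy (by norm_num)]
    have : (24 : ℝ) * u ≤ n := by exact_mod_cast h
    have : (1 : ℝ) ≤ u := by exact_mod_cast hu
    linarith
  set y := (u : ℝ) / ((n : ℝ) - 1) with hydef
  have hypos : 0 < y := by positivity
  have e6 : 1 ≤ C * y ^ u := by
    have : (((n : ℝ) - 1) / u) ^ u * y ^ u = 1 := by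
      rw [← mul_pow, hydef]
      have : ((n : ℝ) - 1) / u * (u / ((n : ℝ) - 1)) = 1 := by field_simp
      rw [this, one_pow]
    rw [← this]
    gcongr
  -- As 8192 = 8 · 1024, this gives 1024 y³ ≤ 1/8. All but one of the u factors are replaced by 1/8,
  -- and 8^u absorbs the u³ in the factor kept.
  have e7 : y ^ 3 ≤ 1 / 8192 := by
    calc y ^ 3 ≤ (1 / 23) ^ 3 := by gcongr
      _ ≤ _ := by norm_num
  have e8 : (u : ℝ) ^ 3 ≤ 8 ^ u := by
    calc (u : ℝ) ^ 3 ≤ (2 ^ u) ^ 3 := by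
          gcongr
          exact_mod_cast (Nat.lt_two_pow_self (n := u)).le
      _ = 8 ^ u := by rw [← pow_mul, mul_comm, pow_mul]; norm_num
  calc (n.choose u : ℝ) * ((n - u).choose u : ℝ) * (((u + u - 1).choose u : ℝ) / C) ^ 5
      ≤ (2 * C) * (2 * C) * (4 ^ u / C) ^ 5 := by gcongr
    _ = 4 * 1024 ^ u * (1 / C) ^ 3 := by
        have : (4 ^ u : ℝ) ^ 5 = 1024 ^ u := by rw [← pow_mul, mul_comm, pow_mul]; norm_num
        rw [div_pow, this]; field_simp; norm_num
    _ ≤ 4 * 1024 ^ u * (y ^ u) ^ 3 := by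
        gcongr
        rw [div_le_iff₀ hCpos]; linarith
    _ = 4 * (1024 * y ^ 3) ^ u := by rw [mul_pow, ← pow_mul, ← pow_mul, mul_comm u 3]; ring
    _ = 4 * ((1024 * y ^ 3) * (1024 * y ^ 3) ^ (u - 1)) := by
        rw [← pow_succ', Nat.sub_add_cancel hu]
    _ ≤ 4 * ((1024 * y ^ 3) * (1 / 8) ^ (u - 1)) := by gcongr; linarith
    _ = 32768 * ((u : ℝ) ^ 3 / 8 ^ u) / ((n : ℝ) - 1) ^ 3 := by
        have : (8 : ℝ) ^ u = 8 ^ (u - 1) * 8 := by rw [← pow_succ, Nat.sub_add_cancel hu]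
        rw [hydef, this, div_pow, div_pow, one_pow]
        field_simp
        norm_num
    _ ≤ 32768 * 1 / ((n : ℝ) - 1) ^ 3 := by
        gcongr
        rw [div_le_one (by positivity)]; exact e8
    _ = _ := by ring

/-- The number of separators and the numerator binom(t+u-1, t-1) select at most t objects, so both
are at most E ≤ e^(n/100), whereas 2C ≥ 2^u ≥ e^(0.023n). The total 2E⁶/C⁴ decays because 6/100 < 4
· 0.023. -/
theorem choiceLaw_real_encloses_small_separator_le {n u t : ℕ} (ht : 1 ≤ t) (htn : 1000 * t ≤ n)
    (hu : n ≤ 30 * u) (hun : 2 * u ≤ n) :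
    (choiceLaw n 5).real {c | ∃ U S, Disjoint U S ∧ U.card = u ∧ S.card = t ∧
      Encloses (graph c) U S} ≤ 32 * Real.exp (-(n / 40 : ℝ)) := by
  have h1 := choiceLaw_real_exists_pair_le (n := n) (k := 5) (fun c U S => Encloses (graph c) U S)
    u t ((((t + u - 1).choose u : ℝ) / ((n - 1).choose u : ℝ)) ^ 5) (by
      intro U S hd hU hS
      have := choiceLaw_real_encloses_le (k := 5) hd (card_pos.1 (by omega))
      rwa [hU, hS, ascFactorial_mul_factorial_div (by omega)] at this)
  refine h1.trans ?_
  set C := ((n - 1).choose u : ℝ) with hC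
  have hCpos : 0 < C := by
    rw [hC]; exact_mod_cast Nat.choose_pos (show u ≤ n - 1 by omega)
  -- Bounds a binomial coefficient by one term of (1 + p)^n, with p = 1/1024 close to the largest
  -- ratio t/n allowed.
  set E := (1024 : ℝ) ^ t * (1 + 1 / 1024) ^ n with hE
  have hEpos : 0 < E := by positivity
  have choose_le : ∀ a b, b ≤ t → b ≤ a → a ≤ n → (a.choose b : ℝ) ≤ E := by
    intro a b hb hba han
    have := choose_mul_pow_le (p := 1 / 1024) (by norm_num) hba
    rw [one_div, inv_pow, ← div_eq_mul_inv, div_le_iff₀ (by positivity)] at this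
    calc (a.choose b : ℝ) ≤ (1 + 1024⁻¹) ^ a * 1024 ^ b := this
      _ ≤ (1 + 1024⁻¹) ^ n * 1024 ^ t := by gcongr <;> norm_num
      _ = E := by rw [hE, one_div]; ring
  have e1 : (n.choose u : ℝ) ≤ 2 * C := by
    rw [hC]; exact_mod_cast choose_le_two_mul_choose_pred (n := n) (u := u) (by omega) hun
  have e2 : ((n - u).choose t : ℝ) ≤ E := choose_le _ _ le_rfl (by omega) (by omega)
  have e3 : ((t + u - 1).choose u : ℝ) ≤ E := by
    rw [Nat.choose_symm_of_eq_add (show t + u - 1 = u + (t - 1) by omega)]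
    exact choose_le _ _ (by omega) (by omega) (by omega)
  have e4 : (2 : ℝ) ^ u ≤ 2 * C := by
    have h3 := pow_le_pow_mul_choose (show u ≤ n by omega)
    have h4 : (2 * u) ^ u ≤ n ^ u := Nat.pow_le_pow_left hun u
    rw [mul_pow, mul_comm] at h4
    have h5 := Nat.le_of_mul_le_mul_left (h4.trans h3) (Nat.pow_pos (by omega))
    exact le_trans (by exact_mod_cast h5) e1
  have l2 := Real.log_two_gt_d9
  have l2' := Real.log_two_lt_d9
  have hE' : E ≤ Real.exp (n / 100) := by
    have h3 : (1 + 1 / 1024 : ℝ) ≤ Real.exp (1 / 1024) := by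
      have := Real.add_one_le_exp (1 / 1024 : ℝ); linarith
    have h4 : (1024 : ℝ) ≤ Real.exp 7 := by
      rw [← Real.log_le_iff_le_exp (by norm_num), show (1024 : ℝ) = 2 ^ 10 by norm_num, Real.log_pow]
      push_cast; linarith
    calc E ≤ Real.exp 7 ^ t * Real.exp (1 / 1024) ^ n := by rw [hE]; gcongr
      _ = Real.exp (7 * t + n / 1024) := by
          rw [← Real.exp_nat_mul, ← Real.exp_nat_mul, ← Real.exp_add]; ring_nf
      _ ≤ _ := by
          rw [Real.exp_le_exp]
          have : (1000 : ℝ) * t ≤ n := by exact_mod_cast htn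
          linarith
  have hC' : Real.exp (0.023 * n) ≤ 2 * C := by
    refine le_trans ?_ e4
    rw [← Real.le_log_iff_exp_le (by positivity), Real.log_pow]
    have : (n : ℝ) ≤ 30 * u := by exact_mod_cast hu
    nlinarith
  have hinv : 1 / C ≤ 2 * Real.exp (-(0.023 * n)) := by
    rw [Real.exp_neg, div_le_iff₀ hCpos]
    calc (1 : ℝ) = (Real.exp (0.023 * n))⁻¹ * Real.exp (0.023 * n) := by
          rw [inv_mul_cancel₀ (Real.exp_pos _).ne']
      _ ≤ (Real.exp (0.023 * n))⁻¹ * (2 * C) := by gcongr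
      _ = _ := by ring
  calc (n.choose u : ℝ) * ((n - u).choose t : ℝ) * (((t + u - 1).choose u : ℝ) / C) ^ 5
      ≤ (2 * C) * E * (E / C) ^ 5 := by gcongr
    _ = 2 * E ^ 6 * (1 / C) ^ 4 := by field_simp
    _ ≤ 2 * Real.exp (n / 100) ^ 6 * (2 * Real.exp (-(0.023 * n))) ^ 4 := by gcongr
    _ = 32 * Real.exp (6 * (n / 100) + 4 * (-(0.023 * n))) := by
        rw [mul_pow, Real.exp_add, ← Real.exp_nat_mul, ← Real.exp_nat_mul]
        push_cast
        ring
    _ ≤ 32 * Real.exp (-(n / 40 : ℝ)) := by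
        gcongr
        have : (0 : ℝ) ≤ n := by positivity
        linarith

end UniformAttachment

/-! ### Entropy estimate for isolated sets. -/

namespace UniformAttachment

open Finset MeasureTheory
open scoped Nat

/-- Together with `log_factorial_le`, Stirling's formula up to a factor e n, harmless against
exponential decay. -/
theorem mul_log_sub_le_log_factorial {n : ℕ} (hn : 1 ≤ n) :
    n * Real.log n - n ≤ Real.log (n ! : ℝ) := by
  have hn' : (0 : ℝ) < n := by exact_mod_cast hn
  have h := Real.pow_div_factorial_le_exp (n : ℝ) hn'.le n
  have hf : (0 : ℝ) < (n ! : ℝ) := by positivity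
  have h2 := Real.log_le_log (by positivity) h
  rw [Real.log_exp, Real.log_div (by positivity) hf.ne', Real.log_pow] at h2
  linarith

theorem log_factorial_le {n : ℕ} (hn : 1 ≤ n) :
    Real.log (n ! : ℝ) ≤ 1 + Real.log n + n * Real.log n - n := by
  induction n, hn using Nat.le_induction with
  | base => simp
  | succ n hn ih =>
    have hn' : (0 : ℝ) < n := by exact_mod_cast hn
    have h1 := Real.one_sub_inv_le_log_of_pos (show (0 : ℝ) < (n + 1) / n by positivity)
    rw [Real.log_div (by positivity) hn'.ne', inv_div] at h1
    have h2 : 1 - (n : ℝ) / (n + 1) = 1 / (n + 1) := by field_simp; ring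
    rw [h2, div_le_iff₀ (by positivity)] at h1
    rw [Nat.factorial_succ]
    push_cast
    rw [Real.log_mul (by positivity) (by positivity)]
    linarith

theorem choose_mul_choose_mul_le {n i s : ℕ} (h : i + s ≤ n) {a b c : ℝ} (ha : 0 ≤ a)
    (hb : 0 ≤ b) (hc : 0 ≤ c) :
    (n.choose i : ℝ) * ((n - i).choose s : ℝ) * (a ^ i * b ^ s * c ^ (n - i - s)) ≤
      (a + (b + c)) ^ n := by
  have key : ∀ (x y : ℝ) (m j : ℕ), 0 ≤ x → 0 ≤ y → j ≤ m →
      x ^ j * y ^ (m - j) * (m.choose j : ℝ) ≤ (x + y) ^ m := by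
    intro x y m j hx hy hj
    rw [add_pow]
    exact single_le_sum (f := fun j => x ^ j * y ^ (m - j) * (m.choose j : ℝ))
      (fun i _ => by positivity) (mem_range.2 (Nat.lt_succ_of_le hj))
  calc _ = a ^ i * (b ^ s * c ^ (n - i - s) * ((n - i).choose s : ℝ)) * (n.choose i : ℝ) := by ring
    _ ≤ a ^ i * (b + c) ^ (n - i) * (n.choose i : ℝ) := by
        gcongr; exact key b c (n - i) s hb hc (by omega)
    _ ≤ _ := key a (b + c) n i ha (by positivity) (by omega)

/-- Weighted by x^(i+s) c^(n-i-s) with x = i/n, the trinomial coefficient is one term of (2x + c)^n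
≤ exp(n(2x + c - 1)). A free c allows constants instead of the logarithm of 1 - 2x. -/
theorem log_choose_mul_choose_le {n i s : ℕ} (hi : 1 ≤ i) (h : i + s ≤ n) {c : ℝ} (hc : 0 < c) :
    Real.log ((n.choose i : ℝ) * ((n - i).choose s : ℝ)) ≤
      n * (2 * (i / n : ℝ) + c - 1) - (i + s) * Real.log (i / n : ℝ) -
        (n - i - s) * Real.log c := by
  have hi' : (0 : ℝ) < i := by exact_mod_cast hi
  have hn' : (0 : ℝ) < n := by exact_mod_cast (by omega : 0 < n)
  set x : ℝ := i / n with hx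
  have hxpos : 0 < x := by positivity
  have h1 := choose_mul_choose_mul_le h hxpos.le hxpos.le hc.le
  have hM : 0 < (n.choose i : ℝ) * ((n - i).choose s : ℝ) := by
    have h2 := Nat.choose_pos (show i ≤ n by omega)
    have h3 := Nat.choose_pos (show s ≤ n - i by omega)
    positivity
  have h4 : (x + (x + c)) ^ n ≤ Real.exp (n * (2 * x + c - 1)) := by
    rw [Real.exp_nat_mul]
    gcongr
    have := Real.add_one_le_exp (2 * x + c - 1)
    linarith
  have h5 := Real.log_le_log (by positivity) (h1.trans h4)
  generalize (n.choose i : ℝ) * ((n - i).choose s : ℝ) = M at *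
  rw [Real.log_exp, Real.log_mul hM.ne' (by positivity), Real.log_mul (by positivity) (by positivity),
    Real.log_mul (by positivity) (by positivity), Real.log_pow, Real.log_pow, Real.log_pow,
    Nat.cast_sub (by omega), Nat.cast_sub (by omega)] at h5
  linarith

/-- The exponential rate of the expected number of independent sets of density `x` with at most
as many neighbours is negative; `c` is a parameter of the estimate of the multinomial
coefficient. -/
theorem exists_rate_le {x : ℝ} (h0 : 0.00098 ≤ x) (h1 : x ≤ 1 / 2) :
    ∃ c : ℝ, 0 < c ∧ c ≤ 1 ∧ 3 * (x * Real.log x) - (1 - 2 * x) * Real.log c + 2 * x + c - 1 +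
      5 * x + 5 * ((1 - x) * Real.log (1 - x)) ≤ -0.0008 := by
  have l1 := Real.log_two_gt_d9
  have l2 := Real.log_two_lt_d9
  have hconv := Real.convexOn_mul_log.2
  have h34 : Real.log (3 / 4) ≤ -1 / 4 := by
    have := Real.log_le_sub_one_of_pos (show (0 : ℝ) < 3 / 4 by norm_num)
    linarith
  have h14 : Real.log (1 / 4) = -(2 * Real.log 2) := by
    rw [one_div, Real.log_inv, show (4 : ℝ) = 2 ^ 2 by norm_num, Real.log_pow]; norm_num
  have h12 : Real.log (1 / 2) = -Real.log 2 := by rw [one_div, Real.log_inv]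
  have h18 : Real.log (1 / 8) = -(3 * Real.log 2) := by
    rw [one_div, Real.log_inv, show (8 : ℝ) = 2 ^ 3 by norm_num, Real.log_pow]; norm_num
  rcases le_total x (1 / 4) with h | h
  -- With c = 1 the term in log c vanishes. The bound on log x and the chord of y log y over [3/4,
  -- 1] make the rate at most about -0.9 x, and the lower limit on x suffices.
  · refine ⟨1, one_pos, le_rfl, ?_⟩
    have e1 : Real.log x ≤ -(2 * Real.log 2) := h14 ▸ Real.log_le_log (by linarith) h
    have e2 := hconv (x := 1) (y := 3 / 4) (by norm_num) (by norm_num) (a := 1 - 4 * x) (b := 4 * x)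
      (by linarith) (by linarith) (by ring)
    simp only [smul_eq_mul] at e2
    rw [show (1 - 4 * x) * 1 + 4 * x * (3 / 4) = 1 - x by ring, Real.log_one] at e2
    have e3 : x * Real.log x ≤ x * -(2 * Real.log 2) := by gcongr
    rw [Real.log_one]
    nlinarith
  -- For this c, the chords of y log y bound the rate by an affine function of x that is negative at
  -- both ends of [1/4, 1/2].
  · refine ⟨1 / 8, by norm_num, by norm_num, ?_⟩
    have e1 := hconv (x := 1 / 4) (y := 1 / 2) (by norm_num) (by norm_num) (a := 2 - 4 * x)
      (b := 4 * x - 1) (by linarith) (by linarith) (by ring)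
    have e2 := hconv (x := 3 / 4) (y := 1 / 2) (by norm_num) (by norm_num) (a := 2 - 4 * x)
      (b := 4 * x - 1) (by linarith) (by linarith) (by ring)
    simp only [smul_eq_mul] at e1 e2
    rw [show (2 - 4 * x) * (1 / 4) + (4 * x - 1) * (1 / 2) = x by ring, h14, h12] at e1
    rw [show (2 - 4 * x) * (3 / 4) + (4 * x - 1) * (1 / 2) = 1 - x by ring, h12] at e2
    have e3 : (2 - 4 * x) * (3 / 4 * Real.log (3 / 4)) ≤ (2 - 4 * x) * (3 / 4 * (-1 / 4)) := by
      gcongr; linarith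
    rw [h18]
    nlinarith

/-- The exponent is n times the rate of `exists_rate_le`, plus logarithmic terms and at most 12h: 5h
from replacing i + h by i in the base, 7h from the pair count. As h ≤ n/100000, the rate -0.0008
stays below -1/2000. -/
theorem choiceLaw_real_isolates_card_le {n i h : ℕ} (hi : 1 ≤ i) (h1 : 2 * i + h ≤ n)
    (h2 : 98 * n ≤ 100000 * i) (h3 : 100000 * h ≤ n) :
    (choiceLaw n 5).real {c | ∃ U S, Disjoint U S ∧ U.card = i ∧ S.card = i + h ∧
      Isolates (graph c) U S} ≤ Real.exp (5 + 10 * Real.log n - n / 2000) := by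
  have hP := choiceLaw_real_exists_pair_le (n := n) (k := 5) (fun c U S => Isolates (graph c) U S)
    i (i + h) (((((i + h) ^ i * (n - i - 1)! : ℕ) : ℝ) / ((n - 1)! : ℝ)) ^ 5) (by
      intro U S hd hU hS
      have := choiceLaw_real_isolates_le (k := 5) hd (card_pos.1 (by omega))
      rwa [hU, hS] at this)
  refine hP.trans ?_
  have hi' : (0 : ℝ) < i := by exact_mod_cast hi
  have hn' : (1 : ℝ) ≤ n := by exact_mod_cast (by omega : 1 ≤ n)
  have hn0 : (0 : ℝ) < n := by linarith
  have h1' : 2 * (i : ℝ) + h ≤ n := by exact_mod_cast h1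
  have h3' : 100000 * (h : ℝ) ≤ n := by exact_mod_cast h3
  have hh0 : (0 : ℝ) ≤ h := by positivity
  have hni : (0 : ℝ) < (n : ℝ) - i := by linarith
  set x : ℝ := i / n with hx
  have hxn : n * x = i := by rw [hx]; field_simp
  have hx0 : 0.00098 ≤ x := by
    rw [hx, le_div_iff₀ hn0]
    have : 98 * (n : ℝ) ≤ 100000 * i := by exact_mod_cast h2
    linarith
  have hx1 : x ≤ 1 / 2 := by
    rw [hx, div_le_iff₀ hn0]; linarith
  obtain ⟨c, hc0, hc1, hrate⟩ := exists_rate_le hx0 hx1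
  have hlogx : Real.log x = Real.log i - Real.log n := Real.log_div hi'.ne' hn0.ne'
  have hlogx' : Real.log (1 - x) = Real.log (n - i : ℝ) - Real.log n := by
    rw [← Real.log_div hni.ne' hn0.ne']
    congr 1
    rw [hx]; field_simp
  have hlogx7 : -7 ≤ Real.log x := by
    rw [Real.le_log_iff_exp_le (by linarith)]
    have e1 := Real.exp_one_gt_d9
    have e2 : Real.exp (-7) = (Real.exp 1 ^ 7)⁻¹ := by
      rw [← Real.exp_nat_mul, ← Real.exp_neg]; norm_num
    have e3 : (2.7 : ℝ) ^ 7 ≤ Real.exp 1 ^ 7 := by gcongr; linarith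
    rw [e2]
    calc (Real.exp 1 ^ 7)⁻¹ ≤ ((2.7 : ℝ) ^ 7)⁻¹ := by gcongr
      _ ≤ 0.00098 := by norm_num
      _ ≤ x := hx0
  have hlogc : Real.log c ≤ 0 := Real.log_nonpos hc0.le hc1
  have hlogn : 0 ≤ Real.log n := Real.log_nonneg hn'
  have hM := log_choose_mul_choose_le hi (show i + (i + h) ≤ n by omega) hc0
  rw [← hx] at hM
  push_cast at hM
  have hlogs : i * Real.log (i + h : ℝ) ≤ i * Real.log i + h := by
    have e1 := Real.log_le_sub_one_of_pos (show (0 : ℝ) < (i + h) / i by positivity)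
    rw [Real.log_div (by positivity) hi'.ne'] at e1
    have e2 : ((i : ℝ) + h) / i - 1 = h / i := by field_simp; ring
    rw [e2, le_div_iff₀ hi'] at e1
    linarith
  have hfac1 := mul_log_sub_le_log_factorial (show 1 ≤ n by omega)
  have hfac2 := log_factorial_le (show 1 ≤ n - i by omega)
  rw [← Nat.mul_factorial_pred (show n ≠ 0 by omega)] at hfac1
  rw [← Nat.mul_factorial_pred (show n - i ≠ 0 by omega)] at hfac2
  push_cast [Nat.cast_sub (show i ≤ n by omega)] at hfac1 hfac2
  rw [Real.log_mul (by positivity) (by positivity)] at hfac1 hfac2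
  have hCpos : 0 < (n.choose i : ℝ) * ((n - i).choose (i + h) : ℝ) := by
    have e1 := Nat.choose_pos (show i ≤ n by omega)
    have e2 := Nat.choose_pos (show i + h ≤ n - i by omega)
    positivity
  have hBpos : 0 < (((i + h) ^ i * (n - i - 1)! : ℕ) : ℝ) / ((n - 1)! : ℝ) := by
    have : 0 < i + h := by omega
    positivity
  generalize (n.choose i : ℝ) * ((n - i).choose (i + h) : ℝ) = M at *
  rw [← Real.log_le_iff_le_exp (by positivity), Real.log_mul hCpos.ne' (by positivity),
    Real.log_pow, Real.log_div (by positivity) (by positivity)]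
  push_cast
  rw [Real.log_mul (by positivity) (by positivity), Real.log_pow]
  have hbase : i * Real.log (i + h : ℝ) + Real.log ((n - i - 1)! : ℝ) - Real.log ((n - 1)! : ℝ) ≤
      1 + Real.log n + h + n * (x * Real.log x + x + (1 - x) * Real.log (1 - x)) := by
    rw [hlogx, hlogx']
    have : n * (x * (Real.log i - Real.log n) + x +
        (1 - x) * (Real.log (n - i : ℝ) - Real.log n)) =
        i * Real.log i + i + (n - i) * Real.log (n - i : ℝ) - n * Real.log n := by
      have e : n * (x * (Real.log i - Real.log n) + x +
        (1 - x) * (Real.log (n - i : ℝ) - Real.log n)) =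
        (n * x) * (Real.log i - Real.log n) + n * x +
        (n - n * x) * (Real.log (n - i : ℝ) - Real.log n) := by ring
      rw [e, hxn]; ring
    rw [this]
    linarith
  have hmain := mul_le_mul_of_nonneg_left hrate hn0.le
  have hMx : n * (2 * x + c - 1) - ((i : ℝ) + (i + h)) * Real.log x -
      (n - i - (i + h)) * Real.log c + 5 * (n * (x * Real.log x + x + (1 - x) * Real.log (1 - x))) =
      n * (3 * (x * Real.log x) - (1 - 2 * x) * Real.log c + 2 * x + c - 1 + 5 * x +
        5 * ((1 - x) * Real.log (1 - x))) + h * (Real.log c - Real.log x) := by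
    rw [← hxn]; ring
  have herr : h * (Real.log c - Real.log x) ≤ h * 7 := by gcongr; linarith
  norm_num at hmain ⊢
  linarith

end UniformAttachment

/-! ### Assembling the failure bound for even orders. -/

namespace UniformAttachment

open Finset MeasureTheory Filter Topology

/-- An upper bound for the probability that the graph of even order `n` has no perfect matching. -/
noncomputable def failureBound (n : ℕ) : ℝ :=
  n * (32768 / ((n : ℝ) - 1) ^ 3) + n * (32 * Real.exp (-(n / 40 : ℝ))) +
    n * Real.exp (5 + 10 * Real.log n - n / 2000) +
    (∑ r ∈ range 300000, (((2 * 300000 : ℕ) : ℝ) * 2 ^ 5 * r) ^ r) / ((n / 300000 : ℕ) : ℝ)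

theorem choiceLaw_real_no_perfectMatching_le {n : ℕ} (hn : 300000 ≤ n) (heven : Even n) :
    (choiceLaw n 5).real {c | ∀ M : (graph c).Subgraph, ¬ M.IsPerfectMatching} ≤
      failureBound n := by
  have hsub : {c : Choices n 5 | ∀ M : (graph c).Subgraph, ¬ M.IsPerfectMatching} ⊆
      (((⋃ u ∈ Icc 1 (n / 24), {c | ∃ U S, Disjoint U S ∧ U.card = u ∧ S.card = u ∧
        Encloses (graph c) U S}) ∪
      ⋃ u ∈ Icc (n / 30 + 1) (n / 2), {c | ∃ U S, Disjoint U S ∧ U.card = u ∧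
        S.card = n / 1000 ∧ Encloses (graph c) U S}) ∪
      ⋃ i ∈ (Icc 1 n).filter fun i => 2 * i + 3 * (n / 300000) ≤ n ∧ 98 * n ≤ 100000 * i,
        {c | ∃ U S, Disjoint U S ∧ U.card = i ∧ S.card = i + 3 * (n / 300000) ∧
        Isolates (graph c) U S}) ∪
      {c | ∃ F : Finset (Finset (Fin n)), (F : Set (Finset (Fin n))).PairwiseDisjoint id ∧
        3 * (n / 300000) < F.card ∧ ∀ C ∈ F, C.Nonempty ∧ HasInnerDegreeTwo (graph c) C} := by
    intro c hc
    simp only [Set.mem_union, Set.mem_iUnion]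
    -- The thresholds fit the estimates: n/30 + n/1000 ≤ n/24 for the first obstruction, and for the
    -- third n/1000 - 3(n/300000) is at least 0.00098 n, even after rounding, since n ≥ 300000.
    rcases exists_obstruction (by simpa using heven) hc (n / 30) (n / 1000) (3 * (n / 300000))
      (by rw [Fintype.card_fin]; omega) (by omega) with h | h | h | h
    · obtain ⟨U, S, hd, h1, h2, h3, h4⟩ := h
      exact Or.inl (Or.inl (Or.inl ⟨U.card, mem_Icc.2 ⟨h1, by omega⟩, U, S, hd, rfl, h3, h4⟩))
    · obtain ⟨U, S, hd, h1, h2, h3, h4⟩ := h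
      rw [Fintype.card_fin] at h2
      exact Or.inl (Or.inl (Or.inr ⟨U.card, mem_Icc.2 ⟨h1, by omega⟩, U, S, hd, rfl, h3, h4⟩))
    · obtain ⟨U, S, hd, h1, h2, h3, h4⟩ := h
      rw [Fintype.card_fin] at h2
      exact Or.inl (Or.inr ⟨U.card, mem_filter.2 ⟨mem_Icc.2 ⟨by omega, by omega⟩, h2, by omega⟩,
        U, S, hd, rfl, h3, h4⟩)
    · exact Or.inr h
  refine (measureReal_mono hsub (measure_ne_top _ _)).trans ?_
  refine (measureReal_union_le _ _).trans (add_le_add ?_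
    (choiceLaw_real_exists_family_le hn (by norm_num)))
  refine (measureReal_union_le _ _).trans (add_le_add ?_ ?_)
  · refine (measureReal_union_le _ _).trans (add_le_add ?_ ?_)
    · refine (measureReal_biUnion_finset_le _ _).trans ?_
      refine (sum_le_card_nsmul _ _ (32768 / ((n : ℝ) - 1) ^ 3) fun u hu => ?_).trans ?_
      · rw [mem_Icc] at hu
        exact choiceLaw_real_encloses_same_card_le hu.1 (by omega)
      · rw [nsmul_eq_mul, Nat.card_Icc]
        have : (1 : ℝ) ≤ n := by exact_mod_cast (by omega : 1 ≤ n)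
        have : (0 : ℝ) ≤ 32768 / ((n : ℝ) - 1) ^ 3 :=
          div_nonneg (by norm_num) (pow_nonneg (by linarith) _)
        gcongr
        omega
    · refine (measureReal_biUnion_finset_le _ _).trans ?_
      refine (sum_le_card_nsmul _ _ (32 * Real.exp (-(n / 40 : ℝ))) fun u hu => ?_).trans ?_
      · rw [mem_Icc] at hu
        exact choiceLaw_real_encloses_small_separator_le (by omega) (by omega) (by omega) (by omega)
      · rw [nsmul_eq_mul, Nat.card_Icc]
        gcongr
        omega
  · refine (measureReal_biUnion_finset_le _ _).trans ?_
    refine (sum_le_card_nsmul _ _ (Real.exp (5 + 10 * Real.log n - n / 2000))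
      fun i hi => ?_).trans ?_
    · rw [mem_filter, mem_Icc] at hi
      exact choiceLaw_real_isolates_card_le hi.1.1 hi.2.1 hi.2.2 (by omega)
    · rw [nsmul_eq_mul]
      gcongr
      refine (card_filter_le _ _).trans ?_
      rw [Nat.card_Icc]; omega

theorem tendsto_failureBound : Tendsto failureBound atTop (𝓝 0) := by
  have hcast := tendsto_natCast_atTop_atTop (R := ℝ)
  have hexp : ∀ (m : ℕ) (b : ℝ), 0 < b →
      Tendsto (fun n : ℕ => (n : ℝ) ^ m * Real.exp (-(b * n))) atTop (𝓝 0) := by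
    intro m b hb
    have h1 := (Real.tendsto_pow_mul_exp_neg_atTop_nhds_zero m).comp
      (hcast.const_mul_atTop hb)
    have h2 := h1.const_mul ((b ^ m)⁻¹)
    rw [mul_zero] at h2
    refine h2.congr fun n => ?_
    simp only [Function.comp, mul_pow]
    field_simp
  have e1 : Tendsto (fun n : ℕ => (n : ℝ) * (32768 / ((n : ℝ) - 1) ^ 3)) atTop (𝓝 0) := by
    have hinv : Tendsto (fun n : ℕ => ((n : ℝ) - 1)⁻¹) atTop (𝓝 0) :=
      tendsto_inv_atTop_zero.comp (tendsto_atTop_add_const_right _ (-1) hcast)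
    have h1 := ((hinv.pow 2).add (hinv.pow 3)).const_mul 32768
    norm_num at h1
    refine h1.congr' ?_
    filter_upwards [eventually_ge_atTop 2] with n hn
    have : (n : ℝ) - 1 ≠ 0 := by
      have : (2 : ℝ) ≤ n := by exact_mod_cast hn
      linarith
    field_simp
    ring
  have e2 : Tendsto (fun n : ℕ => (n : ℝ) * (32 * Real.exp (-(n / 40 : ℝ)))) atTop (𝓝 0) := by
    have h1 := (hexp 1 (1 / 40) (by norm_num)).const_mul 32
    rw [mul_zero] at h1
    refine h1.congr fun n => ?_
    rw [show -(n / 40 : ℝ) = -(1 / 40 * n) by ring]; ring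
  have e3 : Tendsto (fun n : ℕ => (n : ℝ) * Real.exp (5 + 10 * Real.log n - n / 2000)) atTop
      (𝓝 0) := by
    have h1 := (hexp 11 (1 / 2000) (by norm_num)).const_mul (Real.exp 5)
    rw [mul_zero] at h1
    refine h1.congr' ?_
    filter_upwards [eventually_ge_atTop 1] with n hn
    have hn' : (0 : ℝ) < n := by exact_mod_cast hn
    have h2 : Real.exp (10 * Real.log n) = (n : ℝ) ^ 10 := by
      rw [show (10 : ℝ) * Real.log n = (10 : ℕ) * Real.log n by norm_num, Real.exp_nat_mul,
        Real.exp_log hn']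
    rw [show 5 + 10 * Real.log n - (n : ℝ) / 2000 = 5 + 10 * Real.log n + -(1 / 2000 * n) by ring,
      Real.exp_add, Real.exp_add, h2]
    ring
  have e4 : ∀ K : ℝ, Tendsto (fun n : ℕ => K / ((n / 300000 : ℕ) : ℝ)) atTop (𝓝 0) := fun K =>
    (hcast.comp (Nat.tendsto_div_const_atTop (by norm_num))).const_div_atTop K
  have h := ((e1.add e2).add e3).add
    (e4 (∑ r ∈ range 300000, (((2 * 300000 : ℕ) : ℝ) * 2 ^ 5 * r) ^ r))
  simp only [add_zero] at h
  exact h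

/-! ### Odd orders, by forgetting the last vertex. -/

section

variable {n k : ℕ}

/-- The choices of the first `n` vertices, as choices in the process with `n + 1` vertices. -/
def choiceCastSucc (p : Chooser n × Fin k) : Chooser (n + 1) × Fin k :=
  (⟨p.1.1.castSucc, p.1.2⟩, p.2)

/-- Forget the choices of the last vertex. -/
def dropLast (c : Choices (n + 1) k) : Choices n k := fun p => c (choiceCastSucc p)

theorem choiceCastSucc_injective :
    Function.Injective (choiceCastSucc : Chooser n × Fin k → Chooser (n + 1) × Fin k) := by
  intro p q h
  simp only [choiceCastSucc, Prod.mk.injEq, Subtype.mk.injEq, Fin.castSucc_inj] at h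
  exact Prod.ext (Subtype.ext h.1) h.2

/-- Forgetting the last vertex projects a product measure onto a subset of its coordinates. -/
theorem map_dropLast_choiceLaw : (choiceLaw (n + 1) k).map dropLast = choiceLaw n k := by
  have hmeas : Measurable (dropLast : Choices (n + 1) k → Choices n k) :=
    measurable_pi_lambda _ fun p => measurable_pi_apply (choiceCastSucc p)
  symm
  refine Measure.pi_eq fun s hs => ?_
  rw [Measure.map_apply hmeas (MeasurableSet.univ_pi hs)]
  let s' : (p : Chooser (n + 1) × Fin k) → Set (Fin (p.1.1 : ℕ)) := fun p =>
    if h : (p.1.1 : ℕ) < n then s (⟨⟨p.1.1, h⟩, p.1.2⟩, p.2) else Set.univ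
  have hs' : ∀ p : Chooser n × Fin k, s' (choiceCastSucc p) = s p := fun p =>
    dif_pos p.1.1.2
  have hpre : dropLast ⁻¹' Set.univ.pi s = Set.univ.pi s' := by
    ext c
    simp only [Set.mem_preimage, Set.mem_univ_pi]
    constructor
    · intro h p
      by_cases hp : (p.1.1 : ℕ) < n
      · have := h (⟨⟨p.1.1, hp⟩, p.1.2⟩, p.2)
        simp only [s', dif_pos hp]
        exact this
      · simp [s', hp]
    · intro h p
      have := h (choiceCastSucc p)
      rw [hs'] at this
      exact this
  rw [hpre, choiceLaw, Measure.pi_pi]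
  symm
  refine Fintype.prod_of_injective choiceCastSucc choiceCastSucc_injective _ _ ?_ ?_
  · intro p hp
    have : ¬ (p.1.1 : ℕ) < n := fun h => hp ⟨(⟨⟨p.1.1, h⟩, p.1.2⟩, p.2), rfl⟩
    simp [s', this]
  · intro p
    rw [hs']
    rfl

theorem hasPerfectMatching_of_isPerfectMatching {V : Type*} {G : SimpleGraph V}
    {M : G.Subgraph} (hM : M.IsPerfectMatching) : HasPerfectMatching G := by
  refine ⟨M, hM.1, ?_⟩
  rw [hM.2.verts_eq_univ]
  simp

/-- The image of the matching misses only the last vertex. -/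
theorem hasPerfectMatching_of_dropLast {c : Choices (n + 1) k} {M : (graph (dropLast c)).Subgraph}
    (hM : M.IsPerfectMatching) : HasPerfectMatching (graph c) := by
  let f : graph (dropLast c) →g graph c :=
    ⟨Fin.castSucc, by
      intro u v huv
      obtain ⟨p, hp⟩ := graph_adj_iff.1 huv
      refine graph_adj_iff.2 ⟨choiceCastSucc p, ?_⟩
      rcases hp with ⟨rfl, h⟩ | ⟨rfl, h⟩
      · exact Or.inl ⟨rfl, h⟩
      · exact Or.inr ⟨rfl, h⟩⟩
  refine ⟨M.map f, hM.1.map f (Fin.castSucc_injective n), ?_⟩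
  rw [Set.encard_le_one_iff_subsingleton]
  have h : ∀ v, v ∈ (M.map f).vertsᶜ → v = Fin.last n := by
    intro v hv
    by_contra hne
    obtain ⟨w, rfl⟩ := Fin.exists_castSucc_eq.2 hne
    refine hv ?_
    rw [SimpleGraph.Subgraph.map_verts]
    exact ⟨w, hM.2 w, rfl⟩
  intro v hv w hw
  rw [h v hv, h w hw]

theorem choiceLaw_real_succ_no_perfectMatching_le :
    (choiceLaw (n + 1) k).real {c | ¬ HasPerfectMatching (graph c)} ≤
      (choiceLaw n k).real {c | ∀ M : (graph c).Subgraph, ¬ M.IsPerfectMatching} := by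
  have hmeas : Measurable (dropLast : Choices (n + 1) k → Choices n k) :=
    measurable_pi_lambda _ fun p => measurable_pi_apply (choiceCastSucc p)
  rw [← map_dropLast_choiceLaw (n := n), map_measureReal_apply hmeas (Set.toFinite _).measurableSet]
  refine measureReal_mono ?_ (measure_ne_top _ _)
  intro c hc M hM
  exact hc (hasPerfectMatching_of_dropLast hM)

theorem choiceLaw_real_not_hasPerfectMatching_le (hn : 300001 ≤ n) :
    (choiceLaw n 5).real {c | ¬ HasPerfectMatching (graph c)} ≤
      max (failureBound n) (failureBound (n - 1)) := by
  rcases Nat.even_or_odd n with h | h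
  · refine le_max_of_le_left (le_trans ?_ (choiceLaw_real_no_perfectMatching_le (by omega) h))
    refine measureReal_mono ?_ (measure_ne_top _ _)
    intro c hc M hM
    exact hc (hasPerfectMatching_of_isPerfectMatching hM)
  · obtain ⟨m, rfl⟩ := Nat.exists_eq_add_of_le' (show 1 ≤ n by omega)
    have hm : Even m := by obtain ⟨x, hx⟩ := h; exact ⟨x, by omega⟩
    exact le_max_of_le_right (choiceLaw_real_succ_no_perfectMatching_le.trans
      (choiceLaw_real_no_perfectMatching_le (by omega) hm))

end

end UniformAttachment

theorem theorem2p2 :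
    Filter.Tendsto
      (fun n : ℕ => UniformAttachment.choiceLaw n 5
        {c | UniformAttachment.HasPerfectMatching (UniformAttachment.graph c)})
      Filter.atTop (nhds 1) := by
  open UniformAttachment MeasureTheory Filter in
  have h0 : Tendsto (fun n : ℕ =>
      (choiceLaw n 5).real {c | ¬ HasPerfectMatching (graph c)}) atTop (nhds 0) := by
    have h1 := tendsto_failureBound.max
      (tendsto_failureBound.comp (tendsto_sub_atTop_nat 1))
    rw [max_self] at h1
    refine tendsto_of_tendsto_of_tendsto_of_le_of_le' tendsto_const_nhds h1
      (Eventually.of_forall fun n => measureReal_nonneg) ?_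
    filter_upwards [eventually_ge_atTop 300001] with n hn
    exact choiceLaw_real_not_hasPerfectMatching_le hn
  have h1 : ∀ n : ℕ, UniformAttachment.choiceLaw n 5
      {c | UniformAttachment.HasPerfectMatching (UniformAttachment.graph c)} =
      ENNReal.ofReal (1 - (UniformAttachment.choiceLaw n 5).real
        {c | ¬ UniformAttachment.HasPerfectMatching (UniformAttachment.graph c)}) := by
    intro n
    have h2 := MeasureTheory.probReal_compl_eq_one_sub (μ := UniformAttachment.choiceLaw n 5)
      (s := {c | ¬ UniformAttachment.HasPerfectMatching (UniformAttachment.graph c)})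
      (Set.toFinite _).measurableSet
    rw [← h2, MeasureTheory.ofReal_measureReal]
    congr 1
    ext c
    simp
  simp only [h1]
  have h3 := ENNReal.tendsto_ofReal (h0.const_sub 1)
  simpa using h3
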